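/- Let $n\ge 1$, $r\ge 2$ be integers. Let $\mathcal H(x)$ be the $n\times n$ matrix with $1$'s on the first subdiagonal, $x$ in the upper right corner and zeros elsewhere, let $\mathcal N$ be the upper shift matrix ($\mathcal N_{i,i+1}=1$, other entries $0$), $G=\mathrm{diag}(0,1,\dots,n-1)$, and for $t=(t_1,\dots,t_{rn})\in\mathbb C^{rn}$, $t_0\in\mathbb C$ put $$D(x)=\frac1{nx}\Big(t_0+\sum_{J=1}^{rn}t_J\,\mathcal H(x)^J-G\Big).$$ A polynomial matrix $A(x)$ has times $t$ if, for some $t_0$, there is a formal gauge $Y(x)=Y_0+Y_1x^{-1}+Y_2x^{-2}+\cdots$, $\det Y_0\neq0$, with $Y'=AY-YD$. Let $U\subseteq\mathbb C^{rn}$ be open and let $A(x;t)=A_r(t)x^{r-1}+A_{r-1}(t)x^{r-2}+\cdots+A_1(t)$ be an $n\times n$ polynomial matrix in $x$ whose coefficients are holomorphic functions of $t\in U$, such that for every $t\in U$: 1. (gauge-fixed form) $A_r=\frac1n\sum_{j=0}^{n-1}t_{rn-j}\mathcal N^j$ and $(A_{r-1})_{n1}=\frac1n t_{rn-1}\neq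 0$; 2. $A(\cdot\,;t)$ has times $t$. Let then $Y=\mathbf 1+U_0+\mathcal O(x^{-1})$, $U_0$ strictly upper triangular and constant in $x$, be the formal gauge normalized in this way; 3. (isomonodromic deformation) for $J=1,\dots,rn$, $$\partial_{t_J}A=\partial_x\mathcal T_J+[\mathcal T_J,A],\qquad \mathcal T_J=\frac1J\big(Y\mathcal H^JY^{-1}\big)_+,$$ where $(\ )_+$ denotes the part with nonnegative powers of $x$. Put $x=q^n$ and let $y$ be the eigenvalue of $A(x;t)$ that has at $q=\infty$ the Puiseux expansion $$y=\frac1n\sum_{J=1}^{rn}t_Jq^{J-n}+\mathcal O(q^{-n}).$$ Let $\zeta_\infty$ be the point of the spectral curve over $x=\infty$, with local parameter $1/q$, and for $K=1,\dots,rn$ set $$H_K=\frac1K\mathop{\mathrm{res}}_{\zeta_\infty}x^{K/n}\,y\,dx ,$$ where the residue is normalized by $\mathop{\mathrm{res}}_{\zeta_\infty}dq/q=1$; that is, $\frac1nKH_K$ is the coefficient of $q^{-n-K}$ in $y$. Then the $H_K$ are holomorphic on $U$, and the differential $$\sum_{K=1}^{rn}H_K\,dt_K$$ is closed on $U$: $\partial_{t_J}H_K=\partial_{t_K}H_J$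 for all $J,K$. -/

import Mathlib

noncomputable section

namespace PolyConn

open scoped LaurentSeries

/-! ### Laurent series at infinity

`LaurentSeries ℂ` is read as the field of formal Laurent series in `1/x` (coefficient of index `m` =
coefficient of `x^(-m)`), and for the spectral curve as the field of formal Laurent series in `1/q`,
where `q` is a fixed `n`-th root of `x`. -/

/-- The variable `x`, as a Laurent series in `1/x`. -/
def X : LaurentSeries ℂ := HahnSeries.single (-1) 1

/-- The derivation `d/dx` of Laurent series in `s = 1/x`, that is `-s² d/ds`. -/
def ddx (f : LaurentSeries ℂ) : LaurentSeries ℂ :=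
  -(HahnSeries.single 2 1 * LaurentSeries.derivative ℂ f)

/-- The polynomial part `(f)₊` (projection onto the nonnegative powers of `x`). -/
def polyPart (f : LaurentSeries ℂ) : Polynomial ℂ :=
  ∑ k ∈ Finset.range ((-f.order).toNat + 1), Polynomial.monomial k (f.coeff (-(k : ℤ)))

/-- A matrix polynomial in `x` as a matrix of Laurent series in `1/x`. -/
def atInfinity {n : ℕ} (A : Matrix (Fin n) (Fin n) (Polynomial ℂ)) :
    Matrix (Fin n) (Fin n) (LaurentSeries ℂ) :=
  A.map (Polynomial.aeval X)

/-! ### The bare connection -/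

/-- The matrix `𝓗(x)`: ones on the first subdiagonal and `x` in the upper right corner
(for `n = 1` it is the `1 × 1` matrix `x`). -/
def bareH (n : ℕ) : Matrix (Fin n) (Fin n) (LaurentSeries ℂ) :=
  Matrix.of fun i j =>
    if (i : ℕ) = (j : ℕ) + 1 then 1
    else if (i : ℕ) = 0 ∧ (j : ℕ) + 1 = n then X
    else 0

/-- `G = diag(0, 1, …, n-1)`. -/
def bareG (n : ℕ) : Matrix (Fin n) (Fin n) (LaurentSeries ℂ) :=
  Matrix.diagonal fun i => ((i : ℕ) : LaurentSeries ℂ)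

/-- The times `(t_1, …, t_N)` are stored as a vector indexed by `Fin N`, the entry of index `k`
being `t_{k+1}`. `time t J` is `t_J`; it is `0` for `J = 0` and for `J > N`. -/
def time {N : ℕ} (t : Fin N → ℂ) (J : ℕ) : ℂ :=
  if h : 1 ≤ J ∧ J ≤ N then t ⟨J - 1, by omega⟩ else 0

/-- The bare connection matrix
`D(x) = (1/(n x)) (t_0 + ∑_{J=1}^{N} t_J 𝓗(x)^J - G)`. -/
def bareD (n : ℕ) {N : ℕ} (t₀ : ℂ) (t : Fin N → ℂ) : Matrix (Fin n) (Fin n) (LaurentSeries ℂ) :=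
  ((n : LaurentSeries ℂ) * X)⁻¹ •
    (t₀ • (1 : Matrix (Fin n) (Fin n) (LaurentSeries ℂ))
      + ∑ J ∈ Finset.Icc 1 N, time t J • bareH n ^ J - bareG n)

/-! ### Formal gauges, times, deformation matrices -/

/-- The coefficient of `x^0` of a matrix of Laurent series in `1/x`. -/
def constCoeff {n : ℕ} (Y : Matrix (Fin n) (Fin n) (LaurentSeries ℂ)) :
    Matrix (Fin n) (Fin n) ℂ :=
  Y.map fun f => f.coeff 0

/-- `Y` is a formal gauge `Y = Y_0 + Y_1 x⁻¹ + Y_2 x⁻² + ⋯` with `det Y_0 ≠ 0`, taking the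
connection `∂_x - A` to the bare connection `∂_x - D` with parameters `t_0, t`, that is
`Y' = A Y - Y D`. Equivalently, `Y Ψ` with
`Ψ = exp (∑_J (t_J / J) 𝓗^J) x^((t_0 - G)/n)` is a formal solution of `Ψ' = A Ψ`. -/
structure IsFormalGauge {n N : ℕ} (A : Matrix (Fin n) (Fin n) (Polynomial ℂ)) (t₀ : ℂ)
    (t : Fin N → ℂ) (Y : Matrix (Fin n) (Fin n) (LaurentSeries ℂ)) : Prop where
  integral : ∀ (a b : Fin n) (m : ℤ), m < 0 → (Y a b).coeff m = 0
  det_ne_zero : (constCoeff Y).det ≠ 0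
  gauge : Y.map ddx = atInfinity A * Y - Y * bareD n t₀ t

/-- `t` is the vector of times of `A`: the parameters `t_1, …, t_N` of a bare connection to which
`∂_x - A` is formally gauge equivalent at infinity (for some exponent `t_0`). -/
def HasTimes {n N : ℕ} (A : Matrix (Fin n) (Fin n) (Polynomial ℂ)) (t : Fin N → ℂ) : Prop :=
  ∃ (t₀ : ℂ) (Y : Matrix (Fin n) (Fin n) (LaurentSeries ℂ)), IsFormalGauge A t₀ t Y

/-- The constant coefficient of `Y` is `1 + U` with `U` strictly upper triangular. -/
def IsNormalized {n : ℕ} (Y : Matrix (Fin n) (Fin n) (LaurentSeries ℂ)) : Prop :=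
  ∀ a b : Fin n, b ≤ a → (constCoeff Y) a b = (1 : Matrix (Fin n) (Fin n) ℂ) a b

/-- The normalized formal gauge `Y = 1 + U + O(x⁻¹)` of a connection `A` with times `t`. -/
def formalGauge {n N : ℕ} (A : Matrix (Fin n) (Fin n) (Polynomial ℂ)) (t : Fin N → ℂ) :
    Matrix (Fin n) (Fin n) (LaurentSeries ℂ) :=
  Classical.epsilon fun Y => ∃ t₀ : ℂ, IsFormalGauge A t₀ t Y ∧ IsNormalized Y

/-- The deformation matrix `𝓣_J(x) = (1/J) (Y 𝓗^J Y⁻¹)₊`. -/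
def deform {n N : ℕ} (A : Matrix (Fin n) (Fin n) (Polynomial ℂ)) (t : Fin N → ℂ) (J : ℕ) :
    Matrix (Fin n) (Fin n) (Polynomial ℂ) :=
  (1 / (J : ℂ)) • ((formalGauge A t * bareH n ^ J * (formalGauge A t)⁻¹).map polyPart)

/-- `A` is a polynomial of degree `r - 1`, `A = A_r x^(r-1) + A_{r-1} x^(r-2) + ⋯`, in the
gauge-fixed form with respect to `t = (t_1, …, t_{rn})`: the leading coefficient is
`A_r = (1/n) ∑_{j=0}^{n-1} t_{rn-j} 𝓝^j`, `𝓝` the upper shift matrix, and the lower left entry of the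
subleading coefficient `A_{r-1}` is `t_{rn-1}/n`, which is nonzero. -/
structure IsGaugeFixed {n : ℕ} (r : ℕ) (t : Fin (r * n) → ℂ)
    (A : Matrix (Fin n) (Fin n) (Polynomial ℂ)) : Prop where
  degree : ∀ (a b : Fin n) (m : ℕ), r ≤ m → (A a b).coeff m = 0
  leading : ∀ a b : Fin n, (A a b).coeff (r - 1) =
    if a ≤ b then time t (r * n - ((b : ℕ) - (a : ℕ))) / n else 0
  subleading : ∀ a b : Fin n, (a : ℕ) + 1 = n → (b : ℕ) = 0 →
    (A a b).coeff (r - 2) = time t (r * n - 1) / n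
  lidskii : time t (r * n - 1) ≠ 0

/-- A family `A(x; t)` of polynomial connections over a set `U` of times is an isomonodromic
deformation: each `A(x; t)` is in gauge-fixed form, has times `t`, its coefficients depend
holomorphically on `t`, and the zero curvature equations
`∂A/∂t_J = ∂𝓣_J/∂x + [𝓣_J, A]` hold for `J = 1, …, rn`. -/
structure IsDeformation (n r : ℕ) (U : Set (Fin (r * n) → ℂ))
    (A : (Fin (r * n) → ℂ) → Matrix (Fin n) (Fin n) (Polynomial ℂ)) : Prop where
  gaugeFixed : ∀ t ∈ U, IsGaugeFixed r t (A t)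
  hasTimes : ∀ t ∈ U, HasTimes (A t) t
  holomorphic : ∀ (a b : Fin n) (m : ℕ), DifferentiableOn ℂ (fun t => (A t a b).coeff m) U
  zeroCurvature : ∀ t ∈ U, ∀ (k : Fin (r * n)) (a b : Fin n) (m : ℕ),
    fderiv ℂ (fun s => (A s a b).coeff m) t (Pi.single k 1) =
      (((deform (A t) t (k + 1)).map Polynomial.derivative
        + (deform (A t) t (k + 1) * A t - A t * deform (A t) t (k + 1))) a b).coeff m

/-! ### The spectral curve at infinity -/

/-- `q^e` as a Laurent series in `1/q`. -/
def qPow (e : ℤ) : LaurentSeries ℂ := HahnSeries.single (-e) 1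

/-- `y` is an eigenvalue of `A(x)`, `x = q^n`, with expansion
`y = (1/n) ∑_{J=1}^{N} t_J q^(J-n) + O(q^(-n))`. -/
def IsSpectralBranch {n N : ℕ} (A : Matrix (Fin n) (Fin n) (Polynomial ℂ)) (t : Fin N → ℂ)
    (y : LaurentSeries ℂ) : Prop :=
  Polynomial.eval y (A.map (Polynomial.aeval (qPow n))).charpoly = 0 ∧
    ∀ J : ℕ, 1 ≤ J → y.coeff ((n : ℤ) - J) = time t J / n

/-- The branch at infinity of the eigenvalue `y` of `A(x)`, in the local parameter `1/q`. -/
def spectralBranch {n N : ℕ} (A : Matrix (Fin n) (Fin n) (Polynomial ℂ)) (t : Fin N → ℂ) :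
    LaurentSeries ℂ :=
  Classical.epsilon fun y => IsSpectralBranch A t y

/-- The residue at the point `ζ_∞` over `x = ∞` of the differential `f dx = f n q^(n-1) dq`,
normalized by `res dq/q = 1` (a small circle around `ζ_∞` is oriented counterclockwise in `q`). -/
def residue (n : ℕ) (f : LaurentSeries ℂ) : ℂ :=
  (f * ((n : LaurentSeries ℂ) * qPow ((n : ℤ) - 1))).coeff 1

/-- `H_K = (1/K) res_{ζ_∞} x^(K/n) y dx`. -/
def hamiltonian {n N : ℕ} (A : Matrix (Fin n) (Fin n) (Polynomial ℂ)) (t : Fin N → ℂ) (K : ℕ) :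
    ℂ :=
  (1 / (K : ℂ)) * residue n (qPow K * spectralBranch A t)

/-- The differential `∑_{K=1}^{N} H_K dt_K` on the space of times. -/
def tauForm {n N : ℕ} (A : (Fin N → ℂ) → Matrix (Fin n) (Fin n) (Polynomial ℂ))
    (t : Fin N → ℂ) : (Fin N → ℂ) →L[ℂ] ℂ :=
  ∑ k : Fin N, hamiltonian (A t) t (k + 1) • ContinuousLinearMap.proj (R := ℂ) (φ := fun _ => ℂ) k

/-- A differential 1-form `ω` is closed on the open set `U`: it is (complex) differentiable there and
its exterior derivative `dω(u, v) = (D_u ω)(v) - (D_v ω)(u)` vanishes. -/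
def IsClosedOn {N : ℕ} (ω : (Fin N → ℂ) → ((Fin N → ℂ) →L[ℂ] ℂ)) (U : Set (Fin N → ℂ)) : Prop :=
  DifferentiableOn ℂ ω U ∧ ∀ t ∈ U, ∀ u v : Fin N → ℂ, fderiv ℂ ω t u v - fderiv ℂ ω t v u = 0

end PolyConn

end

/-!
Put `x = qⁿ` and conjugate by `diag(1, q, …, q^(n-1))`. Taking column sums of the result identifies
the `n × n` matrices of series in `1/x` with the rows of `n` series in `1/q`, and `𝓗` acts on these
rows as multiplication by `q`. The conjugate of a gauge-fixed `A` is
`(t_{rn}/n) q^(rn-n) + (t_{rn-1}/n) q^(rn-n-1) C + ⋯` with `C` a cyclic permutation matrix, so it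
has a row eigenvector `l = (1, …, 1) + O(1/q)`, whose coefficients and eigenvalue `y` are computed
recursively by dividing only by `n` and `t_{rn-1}` and are thus holomorphic in `t`. The matrix `Z`
corresponding to `l` is a spectral counterpart of the inverse of the gauge `Y`: it conjugates `A` to
multiplication by `y`. Comparing `Z` with `Y` shows that `y` is the spectral branch, and that
`Z⁻¹ 𝓗^J Z` and `Y 𝓗^J Y⁻¹` differ by `O(1)` for `J ≤ rn`, hence give the same `∂ₓ 𝓣_J`.

First order perturbation of `y` along `t_J` now gives
`K ∂_J H_K = res tr (Z⁻¹ 𝓗^K Z ∂_J A) = (1/J) res tr (Z⁻¹ 𝓗^K Z d(Z⁻¹ 𝓗^J Z)₊)`,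
since the commutator `[𝓣_J, A]` is orthogonal to `Z⁻¹ 𝓗^K Z`, which commutes with `A`. This pairing
is symmetric in `J` and `K`, because for all `M` and `M'`
`res tr (M dM'₊) - res tr (M' dM₊) = res tr (M dM')`,
and the right-hand side is `res tr (𝓗^K d𝓗^J) = 0` for `M = Z⁻¹ 𝓗^K Z` and `M' = Z⁻¹ 𝓗^J Z`.
-/

noncomputable section

namespace PolyConn

open scoped LaurentSeries

/-- The coefficients of `f` of index less than `a` vanish; for a series in `1/q` this reads
`f = O(q ^ (-a))`. -/
def VanishBelow {k : Type*} [Zero k] (a : ℤ) (f : LaurentSeries k) : Prop :=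
  ∀ m < a, f.coeff m = 0

namespace VanishBelow

variable {k : Type*} [CommRing k] {a b : ℤ} {f g : LaurentSeries k}

theorem mono (hf : VanishBelow a f) (h : b ≤ a) : VanishBelow b f :=
  fun m hm => hf m (hm.trans_le h)

theorem zero : VanishBelow a (0 : LaurentSeries k) := fun _ _ => rfl

theorem sub (hf : VanishBelow a f) (hg : VanishBelow a g) : VanishBelow a (f - g) :=
  fun m hm => by rw [HahnSeries.coeff_sub, hf m hm, hg m hm, sub_zero]

theorem sum {ι : Type*} {s : Finset ι} {f : ι → LaurentSeries k}
    (hf : ∀ i ∈ s, VanishBelow a (f i)) : VanishBelow a (∑ i ∈ s, f i) :=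
  fun m hm => by
    rw [HahnSeries.coeff_sum]
    exact Finset.sum_eq_zero fun i hi => hf i hi m hm

theorem single (a : ℤ) (c : k) : VanishBelow a (HahnSeries.single a c) :=
  fun _ hm => HahnSeries.coeff_single_of_ne hm.ne

theorem ofPowerSeries (p : PowerSeries k) : VanishBelow 0 (HahnSeries.ofPowerSeries ℤ k p) :=
  fun m hm => by rw [PowerSeries.coeff_coe, if_pos hm]

theorem eq_single_mul (hf : VanishBelow a f) :
    f = HahnSeries.single a 1 *
      HahnSeries.ofPowerSeries ℤ k (PowerSeries.mk fun m => f.coeff (a + m)) := by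
  ext m
  rw [HahnSeries.coeff_single_mul, one_mul, PowerSeries.coeff_coe]
  split_ifs with h
  · exact hf m (by omega)
  · rw [PowerSeries.coeff_mk]
    congr 1
    omega

theorem coeff_mul_add (hf : VanishBelow a f) (hg : VanishBelow b g) (m : ℕ) :
    (f * g).coeff (a + b + m) =
      ∑ p ∈ Finset.HasAntidiagonal.antidiagonal m, f.coeff (a + p.1) * g.coeff (b + p.2) := by
  conv_lhs => rw [hf.eq_single_mul, hg.eq_single_mul, mul_mul_mul_comm, ← map_mul,
    HahnSeries.single_mul_single, HahnSeries.coeff_single_mul, mul_one, one_mul,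
    add_sub_cancel_left, LaurentSeries.coeff_coe_powerSeries, PowerSeries.coeff_mul]
  simp only [PowerSeries.coeff_mk]

theorem coeff_mul (hf : VanishBelow a f) (hg : VanishBelow b g) :
    (f * g).coeff (a + b) = f.coeff a * g.coeff b := by
  simpa using hf.coeff_mul_add hg 0

theorem coeff_mul_add_one (hf : VanishBelow a f) (hg : VanishBelow b g) :
    (f * g).coeff (a + b + 1) = f.coeff a * g.coeff (b + 1) + f.coeff (a + 1) * g.coeff b := by
  simpa [Finset.Nat.antidiagonal_succ] using hf.coeff_mul_add hg 1

theorem mul (hf : VanishBelow a f) (hg : VanishBelow b g) : VanishBelow (a + b) (f * g) :=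
  fun m hm => by
    rw [hf.eq_single_mul, hg.eq_single_mul, mul_mul_mul_comm, ← map_mul,
      HahnSeries.single_mul_single, HahnSeries.coeff_single_mul,
      VanishBelow.ofPowerSeries _ _ (by omega), mul_zero]

theorem single_mul (e : ℤ) (c : k) (hf : VanishBelow a f) :
    VanishBelow (e + a) (HahnSeries.single e c * f) :=
  (VanishBelow.single e c).mul hf

theorem of_mul_right [NoZeroDivisors k] (hg : VanishBelow 0 g) (hg₀ : g.coeff 0 ≠ 0)
    (h : VanishBelow a (f * g)) : VanishBelow a f := by
  by_contra hf
  have hf₀ : f ≠ 0 := by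
    rintro rfl
    exact hf zero
  have hfo : VanishBelow f.order f := fun _ hm => HahnSeries.coeff_eq_zero_of_lt_order hm
  have hlt : f.order < a := lt_of_not_ge fun hle => hf (hfo.mono hle)
  have hzero := h (f.order + 0) (by simpa using hlt)
  rw [hfo.coeff_mul hg] at hzero
  exact (mul_ne_zero ((HahnSeries.coeff_order_eq_zero).not.2 hf₀) hg₀) hzero

end VanishBelow

/-! ### Shearing -/

/-- The substitution `x = q ^ n`, from series in `1/x` to series in `1/q`. -/
def expandHom (n : ℕ) [NeZero n] : LaurentSeries ℂ →+* LaurentSeries ℂ :=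
  have hpos : (0 : ℤ) < n := by exact_mod_cast Nat.pos_of_neZero n
  HahnSeries.embDomainRingHom (AddMonoidHom.mulLeft (n : ℤ))
    (mul_right_injective₀ hpos.ne') fun _ _ => mul_le_mul_iff_right₀ hpos

section Expand

variable (n : ℕ) [NeZero n]

theorem coeff_expandHom_mul (f : LaurentSeries ℂ) (m : ℤ) :
    (expandHom n f).coeff (n * m) = f.coeff m :=
  HahnSeries.embDomain_coeff (a := m)

theorem coeff_expandHom_of_not_dvd (f : LaurentSeries ℂ) {m : ℤ} (h : ¬ (n : ℤ) ∣ m) :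
    (expandHom n f).coeff m = 0 :=
  HahnSeries.embDomain_of_notMem_range fun ⟨c, hc⟩ => h ⟨c, hc.symm⟩

theorem expandHom_single (m : ℤ) (c : ℂ) :
    expandHom n (HahnSeries.single m c) = HahnSeries.single (n * m) c :=
  HahnSeries.embDomain_single

theorem algebraMap_eq_C (c : ℂ) : algebraMap ℂ (LaurentSeries ℂ) c = HahnSeries.C c :=
  HahnSeries.ofPowerSeries_C c

theorem expandHom_aeval (p : Polynomial ℂ) :
    expandHom n (Polynomial.aeval X p) = Polynomial.aeval (qPow n) p := by
  have hC : (expandHom n).comp (algebraMap ℂ (LaurentSeries ℂ)) =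
      algebraMap ℂ (LaurentSeries ℂ) := by
    ext1 c
    rw [RingHom.comp_apply, algebraMap_eq_C, HahnSeries.C_apply, expandHom_single, mul_zero]
  rw [Polynomial.aeval_def, Polynomial.hom_eval₂, hC, X, expandHom_single, mul_neg_one, qPow,
    Polynomial.aeval_def]

end Expand

section Shear

variable {n : ℕ} [NeZero n]

/-- The ring homomorphism `M ↦ S M(q ^ n) S⁻¹`, `S = diag(1, q, …, q ^ (n-1))`, whose `(i, j)`
entry is `q ^ (i - j) M_{ij}(q ^ n)`. -/
def shear :
    Matrix (Fin n) (Fin n) (LaurentSeries ℂ) →+* Matrix (Fin n) (Fin n) (LaurentSeries ℂ) where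
  toFun M := Matrix.of fun i j => HahnSeries.single ((j : ℤ) - i) 1 * expandHom n (M i j)
  map_one' := by
    ext1 i j
    rcases eq_or_ne i j with rfl | h
    · simp
    · simp [h]
  map_mul' M M' := by
    ext1 i j
    simp only [Matrix.of_apply, Matrix.mul_apply, map_sum, map_mul, Finset.mul_sum]
    refine Finset.sum_congr rfl fun l _ => ?_
    rw [mul_mul_mul_comm, HahnSeries.single_mul_single, mul_one]
    congr 3
    ring
  map_zero' := by
    ext1 i j
    simp
  map_add' M M' := by
    ext1 i j
    simp [mul_add]

theorem shear_apply (M : Matrix (Fin n) (Fin n) (LaurentSeries ℂ)) (i j : Fin n) :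
    shear M i j = HahnSeries.single ((j : ℤ) - i) 1 * expandHom n (M i j) := rfl

theorem exists_shear_eq_conj : ∃ S : (Matrix (Fin n) (Fin n) (LaurentSeries ℂ))ˣ,
    ∀ M : Matrix (Fin n) (Fin n) (LaurentSeries ℂ),
      shear M = S.val * (expandHom n).mapMatrix M * S⁻¹.val := by
  have hunit : ∀ e : ℤ, Matrix.diagonal (fun i : Fin n => HahnSeries.single (e * i) (1 : ℂ)) *
      Matrix.diagonal (fun i : Fin n => HahnSeries.single (-e * i) (1 : ℂ)) = 1 := fun e => by
    simp [Matrix.diagonal_mul_diagonal, HahnSeries.single_mul_single]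
  refine ⟨⟨_, _, hunit (-1), by simpa only [neg_neg] using hunit (- -1)⟩, fun M => ?_⟩
  ext1 i j
  rw [Units.inv_mk, Matrix.mul_diagonal, Matrix.diagonal_mul, mul_right_comm,
    HahnSeries.single_mul_single, mul_one, shear_apply, RingHom.mapMatrix_apply, Matrix.map_apply]
  congr 3
  ring

theorem det_shear (M : Matrix (Fin n) (Fin n) (LaurentSeries ℂ)) :
    (shear M).det = expandHom n M.det := by
  obtain ⟨S, hS⟩ := exists_shear_eq_conj (n := n)
  rw [hS, Matrix.det_units_conj, RingHom.map_det]

/-- The column sums of the sheared matrix. They identify the `n × n` matrices of series in `1/x`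
with the rows of `n` series in `1/q`; the inverse map is `unshear`. -/
def colSum : Matrix (Fin n) (Fin n) (LaurentSeries ℂ) →+ (Fin n → LaurentSeries ℂ) where
  toFun M := Matrix.vecMul 1 (shear M)
  map_zero' := by rw [map_zero, Matrix.vecMul_zero]
  map_add' M M' := by rw [map_add, Matrix.vecMul_add]

/-- The matrix whose sheared matrix has the prescribed column sums `u`. -/
def unshear (u : Fin n → LaurentSeries ℂ) : Matrix (Fin n) (Fin n) (LaurentSeries ℂ) :=
  Matrix.of fun i j => HahnSeries.ofSuppBddBelow (fun k => (u j).coeff (n * k + j - i)) <| by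
    refine ⟨-|(u j).order| - n, fun k hk => ?_⟩
    by_contra hlt
    refine hk (HahnSeries.coeff_eq_zero_of_lt_order ?_)
    have hn : (1 : ℤ) ≤ n := by exact_mod_cast Nat.pos_of_neZero n
    have hj : ((j : ℕ) : ℤ) < n := by exact_mod_cast j.2
    have horder := neg_abs_le (u j).order
    have habs := abs_nonneg (u j).order
    have hbound : k ≤ -|(u j).order| - n - 1 := by omega
    nlinarith [hbound]

variable (M : Matrix (Fin n) (Fin n) (LaurentSeries ℂ))

theorem exists_index (j : Fin n) (m : ℤ) : ∃ (i : Fin n) (k : ℤ), m = n * k + j - i := by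
  have hn : (0 : ℤ) < n := by exact_mod_cast Nat.pos_of_neZero n
  have hnonneg := Int.emod_nonneg (j - m : ℤ) hn.ne'
  have hlt := Int.emod_lt_of_pos (j - m : ℤ) hn
  refine ⟨⟨((j - m : ℤ) % n).toNat, by omega⟩, -((j - m : ℤ) / n), ?_⟩
  have := Int.mul_ediv_add_emod (j - m : ℤ) n
  simp only [Int.toNat_of_nonneg hnonneg]
  linarith

theorem coeff_shear (i j : Fin n) (k : ℤ) :
    (shear M i j).coeff (n * k + j - i) = (M i j).coeff k := by
  rw [shear_apply, HahnSeries.coeff_single_mul, one_mul,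
    show (n : ℤ) * k + j - i - (j - i) = n * k by ring, coeff_expandHom_mul]

theorem coeff_shear_of_ne {i i' : Fin n} (h : i' ≠ i) (j : Fin n) (k : ℤ) :
    (shear M i' j).coeff (n * k + j - i) = 0 := by
  rw [shear_apply, HahnSeries.coeff_single_mul, one_mul, coeff_expandHom_of_not_dvd]
  rintro ⟨c, hc⟩
  have hdvd : (n : ℤ) ∣ (i' : ℤ) - i := ⟨c - k, by linarith⟩
  have habs : |(i' : ℤ) - i| < n := by
    rw [abs_lt]
    omega
  have := Int.eq_zero_of_abs_lt_dvd hdvd habs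
  exact h (Fin.ext (by omega))

theorem colSum_apply (j : Fin n) : colSum M j = ∑ i, shear M i j := by
  simp [colSum, Matrix.vecMul, dotProduct]

theorem coeff_colSum (i j : Fin n) (k : ℤ) :
    (colSum M j).coeff (n * k + j - i) = (M i j).coeff k := by
  rw [colSum_apply, HahnSeries.coeff_sum,
    Finset.sum_eq_single_of_mem i (Finset.mem_univ i) fun i' _ h => coeff_shear_of_ne M h j k,
    coeff_shear]

theorem colSum_injective :
    Function.Injective (colSum : Matrix (Fin n) (Fin n) (LaurentSeries ℂ) →+ _) := by
  intro M M' h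
  ext i j k
  rw [← coeff_colSum, h, coeff_colSum]

theorem colSum_unshear (u : Fin n → LaurentSeries ℂ) : colSum (unshear u) = u := by
  ext j m
  obtain ⟨i, k, rfl⟩ := exists_index j m
  exact coeff_colSum _ i j k

theorem colSum_mul (M' : Matrix (Fin n) (Fin n) (LaurentSeries ℂ)) :
    colSum (M * M') = Matrix.vecMul (colSum M) (shear M') := by
  simp only [colSum, AddMonoidHom.coe_mk, ZeroHom.coe_mk, map_mul, Matrix.vecMul_vecMul]

theorem vanishBelow_shear {M : Matrix (Fin n) (Fin n) (LaurentSeries ℂ)} {a : ℤ}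
    (h : ∀ j, VanishBelow a (colSum M j)) (i j : Fin n) : VanishBelow a (shear M i j) := by
  intro m hm
  obtain ⟨i', k, rfl⟩ := exists_index j m
  rcases eq_or_ne i i' with rfl | hi
  · rw [coeff_shear, ← coeff_colSum]
    exact h j _ hm
  · exact coeff_shear_of_ne M hi j k

/-- The matrix of multiplication by a series `f` in `1/q`: under `colSum` the product
`mulMat f * M` corresponds to the row `f • colSum M`. -/
def mulMat (f : LaurentSeries ℂ) : Matrix (Fin n) (Fin n) (LaurentSeries ℂ) :=
  unshear fun _ => f

theorem coeff_mulMat (f : LaurentSeries ℂ) (i j : Fin n) (k : ℤ) :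
    (mulMat f i j).coeff k = f.coeff (n * k + j - i) := rfl

theorem colSum_mulMat (f : LaurentSeries ℂ) (j : Fin n) :
    colSum (mulMat f : Matrix (Fin n) (Fin n) _) j = f := by
  rw [mulMat, colSum_unshear]

theorem colSum_mulMat_mul (f : LaurentSeries ℂ) : colSum (mulMat f * M) = f • colSum M := by
  ext1 j
  rw [colSum_mul, Matrix.vecMul, dotProduct, Pi.smul_apply, colSum_apply, Finset.smul_sum]
  simp only [colSum_mulMat, smul_eq_mul]

theorem mulMat_mul (f g : LaurentSeries ℂ) :
    (mulMat (f * g) : Matrix (Fin n) (Fin n) _) = mulMat f * mulMat g := by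
  apply colSum_injective
  ext1 j
  rw [colSum_mulMat_mul, Pi.smul_apply, colSum_mulMat, colSum_mulMat, smul_eq_mul]

theorem mulMat_one : (mulMat 1 : Matrix (Fin n) (Fin n) _) = 1 := by
  apply colSum_injective
  ext1 j
  rw [colSum_mulMat]
  simp only [colSum, AddMonoidHom.coe_mk, ZeroHom.coe_mk, map_one, Matrix.vecMul_one,
    Pi.one_apply]

theorem trace_mulMat_coeff (f : LaurentSeries ℂ) (k : ℤ) :
    (Matrix.trace (mulMat f : Matrix (Fin n) (Fin n) _)).coeff k = n * f.coeff (n * k) := by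
  simp [Matrix.trace, HahnSeries.coeff_sum, coeff_mulMat]

theorem qPow_mul_qPow (a b : ℤ) : qPow a * qPow b = qPow (a + b) := by
  rw [qPow, qPow, qPow, HahnSeries.single_mul_single, mul_one, neg_add]

theorem bareH_eq_mulMat : bareH n = mulMat (qPow 1) := by
  ext i j k
  have hi := i.2
  have hj := j.2
  have hindex : (n * k + j - i = -(1 : ℤ)) ↔ ((i : ℕ) = j + 1 ∧ k = 0) ∨
      (((i : ℕ) = 0 ∧ (j : ℕ) + 1 = n) ∧ k = -1) := by
    constructor
    · intro e
      rcases lt_trichotomy k 0 with hlt | rfl | hgt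
      · obtain rfl : k = -1 := by nlinarith
        omega
      · omega
      · nlinarith
    · rintro (⟨h, rfl⟩ | ⟨⟨h, h'⟩, rfl⟩) <;> omega
  rw [coeff_mulMat, qPow, HahnSeries.coeff_single, bareH, Matrix.of_apply]
  simp only [hindex]
  split_ifs <;>
    simp only [HahnSeries.coeff_one, X, HahnSeries.coeff_single, HahnSeries.coeff_zero] <;>
    first | rw [if_pos (by omega)] | rw [if_neg (by omega)] | omega

theorem bareH_pow_eq_mulMat (J : ℕ) : bareH n ^ J = mulMat (qPow J) := by
  induction J with
  | zero => exact mulMat_one.symm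
  | succ J ih => rw [pow_succ, ih, bareH_eq_mulMat, ← mulMat_mul, qPow_mul_qPow, Nat.cast_succ]

theorem eq_add_ofNat {i j : Fin n} {J : ℕ} {k : ℤ} (h : n * k + j - i = -(J : ℤ)) :
    i = j + Fin.ofNat n J := by
  apply Fin.ext
  rw [Fin.val_add, Fin.val_ofNat, Nat.add_mod_mod]
  have hmod : (((j : ℕ) + J : ℕ) : ℤ) % n = i % n := by
    rw [show (((j : ℕ) + J : ℕ) : ℤ) = i + n * (-k) by push_cast; linarith,
      Int.add_mul_emod_self_left]
  rw [← Nat.mod_eq_of_lt i.2]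
  exact_mod_cast hmod.symm

theorem shear_bareH_pow (J : ℕ) (i j : Fin n) :
    shear (bareH n ^ J) i j = if i = j + Fin.ofNat n J then qPow J else 0 := by
  rw [bareH_pow_eq_mulMat]
  ext m
  obtain ⟨i', k, rfl⟩ := exists_index j m
  have hcoeff : (qPow J).coeff (n * k + j - i') ≠ 0 → i' = j + Fin.ofNat n J := fun h =>
    eq_add_ofNat (by_contra fun hne => h (HahnSeries.coeff_single_of_ne hne))
  rcases eq_or_ne i i' with rfl | hi
  · rw [coeff_shear, coeff_mulMat]
    split_ifs with h
    · rfl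
    · exact not_imp_comm.1 hcoeff h
  · rw [coeff_shear_of_ne _ hi]
    split_ifs with h
    · exact (not_imp_comm.1 hcoeff fun h' => hi (h.trans h'.symm)).symm
    · rfl

theorem colSum_mul_bareH_pow (J : ℕ) (j : Fin n) :
    colSum (M * bareH n ^ J) j = qPow J * colSum M (j + Fin.ofNat n J) := by
  simp [colSum_mul, Matrix.vecMul, dotProduct, shear_bareH_pow, mul_comm]

end Shear

/-! ### Differentials and residues -/

theorem coeff_ddx (f : LaurentSeries ℂ) (m : ℤ) :
    (ddx f).coeff m = -((m - 1 : ℤ) * f.coeff (m - 1)) := by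
  rw [ddx, HahnSeries.coeff_neg, HahnSeries.coeff_single_mul, one_mul,
    LaurentSeries.derivative_apply, LaurentSeries.hasseDeriv_coeff, Ring.choose_one_right,
    zsmul_eq_mul, Nat.cast_one, show m - 2 + 1 = m - 1 by ring]

theorem ddx_sub (f g : LaurentSeries ℂ) : ddx (f - g) = ddx f - ddx g := by
  rw [ddx, map_sub, mul_sub, neg_sub', ddx, ddx]

theorem ddx_sum {ι : Type*} (s : Finset ι) (f : ι → LaurentSeries ℂ) :
    ddx (∑ i ∈ s, f i) = ∑ i ∈ s, ddx (f i) := by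
  simp only [ddx, map_sum, Finset.mul_sum, Finset.sum_neg_distrib]

theorem ddx_C (c : ℂ) : ddx (HahnSeries.C c) = 0 := by
  ext m
  rw [coeff_ddx, HahnSeries.C_apply, HahnSeries.coeff_single, HahnSeries.coeff_zero]
  split_ifs with h
  · rw [h, Int.cast_zero, zero_mul, neg_zero]
  · rw [mul_zero, neg_zero]

theorem VanishBelow.ddx {f : LaurentSeries ℂ} {a : ℤ} (hf : VanishBelow a f) :
    VanishBelow (a + 1) (ddx f) := fun m hm => by
  rw [coeff_ddx, hf _ (by omega), mul_zero, neg_zero]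

theorem coeff_one_ddx (f : LaurentSeries ℂ) : (ddx f).coeff 1 = 0 := by
  rw [coeff_ddx, sub_self, Int.cast_zero, zero_mul, neg_zero]

/-- The Euler operator `x d/dx`, which multiplies the coefficient of index `m` by `-m`. -/
def euler (f : LaurentSeries ℂ) : LaurentSeries ℂ := X * ddx f

theorem coeff_euler (f : LaurentSeries ℂ) (m : ℤ) : (euler f).coeff m = -(m * f.coeff m) := by
  rw [euler, X, HahnSeries.coeff_single_mul, one_mul, coeff_ddx, sub_neg_eq_add,
    add_sub_cancel_right]

theorem support_euler_subset (f : LaurentSeries ℂ) : (euler f).support ⊆ f.support := by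
  intro m hm hf
  exact hm (by rw [coeff_euler, hf, mul_zero, neg_zero])

theorem euler_mul (f g : LaurentSeries ℂ) : euler (f * g) = euler f * g + f * euler g := by
  ext m
  rw [coeff_euler, HahnSeries.coeff_add, HahnSeries.coeff_mul,
    HahnSeries.coeff_mul_left' f.isPWO_support (support_euler_subset f),
    HahnSeries.coeff_mul_right' g.isPWO_support (support_euler_subset g), Finset.mul_sum,
    ← Finset.sum_neg_distrib, ← Finset.sum_add_distrib]
  refine Finset.sum_congr rfl fun p hp => ?_
  rw [coeff_euler, coeff_euler, ← (Finset.mem_antidiagonal.1 hp).2.2]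
  push_cast
  ring

theorem X_ne_zero : X ≠ 0 := HahnSeries.single_ne_zero one_ne_zero

theorem ddx_mul (f g : LaurentSeries ℂ) : ddx (f * g) = ddx f * g + f * ddx g := by
  refine mul_left_cancel₀ X_ne_zero ?_
  simpa only [euler, mul_add, mul_assoc, mul_left_comm X f] using euler_mul f g

theorem aeval_X_monomial (m : ℕ) (c : ℂ) :
    Polynomial.aeval X (Polynomial.monomial m c) = HahnSeries.single (-(m : ℤ)) c := by
  rw [Polynomial.aeval_monomial, algebraMap_eq_C, X, HahnSeries.single_pow, HahnSeries.C_apply,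
    HahnSeries.single_mul_single, one_pow, mul_one, zero_add, nsmul_eq_mul, mul_neg_one]

theorem coeff_aeval_X (p : Polynomial ℂ) (m : ℕ) :
    (Polynomial.aeval X p).coeff (-(m : ℤ)) = p.coeff m := by
  induction p using Polynomial.induction_on' with
  | add p q hp hq => rw [map_add, HahnSeries.coeff_add, hp, hq, Polynomial.coeff_add]
  | monomial k c =>
    rw [aeval_X_monomial, HahnSeries.coeff_single, Polynomial.coeff_monomial]
    simp [eq_comm]

theorem coeff_aeval_X_of_pos (p : Polynomial ℂ) {m : ℤ} (hm : 0 < m) :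
    (Polynomial.aeval X p).coeff m = 0 := by
  induction p using Polynomial.induction_on' with
  | add p q hp hq => rw [map_add, HahnSeries.coeff_add, hp, hq, add_zero]
  | monomial k c => rw [aeval_X_monomial, HahnSeries.coeff_single_of_ne (by omega)]

theorem ddx_aeval_X (p : Polynomial ℂ) :
    ddx (Polynomial.aeval X p) = Polynomial.aeval X (Polynomial.derivative p) := by
  ext m
  rw [coeff_ddx]
  rcases lt_trichotomy m 1 with h | rfl | h
  · obtain ⟨k, rfl⟩ := Int.exists_eq_neg_ofNat (Int.lt_add_one_iff.1 h)
    rw [show -(k : ℤ) - 1 = -((k + 1 : ℕ) : ℤ) by push_cast; ring, coeff_aeval_X, coeff_aeval_X,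
      Polynomial.coeff_derivative]
    push_cast
    ring
  · rw [coeff_aeval_X_of_pos _ one_pos, sub_self, Int.cast_zero, zero_mul, neg_zero]
  · rw [coeff_aeval_X_of_pos _ (by omega), coeff_aeval_X_of_pos _ (by omega), mul_zero, neg_zero]

theorem coeff_polyPart (f : LaurentSeries ℂ) (m : ℕ) :
    (polyPart f).coeff m = f.coeff (-(m : ℤ)) := by
  rw [polyPart, Polynomial.finsetSum_coeff]
  simp only [Polynomial.coeff_monomial, Finset.sum_ite_eq', Finset.mem_range]
  split_ifs with h
  · rfl
  · exact (HahnSeries.coeff_eq_zero_of_lt_order (by omega)).symm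

/-- The part of a Laurent series with nonnegative powers of `x`, as a Laurent series. -/
def nonnegPart (f : LaurentSeries ℂ) : LaurentSeries ℂ := Polynomial.aeval X (polyPart f)

theorem coeff_nonnegPart (f : LaurentSeries ℂ) (m : ℤ) :
    (nonnegPart f).coeff m = if m ≤ 0 then f.coeff m else 0 := by
  split_ifs with h
  · obtain ⟨k, rfl⟩ := Int.exists_eq_neg_ofNat h
    rw [nonnegPart, coeff_aeval_X, coeff_polyPart]
  · exact coeff_aeval_X_of_pos _ (not_le.1 h)

theorem vanishBelow_sub_nonnegPart (f : LaurentSeries ℂ) : VanishBelow 1 (f - nonnegPart f) :=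
  fun m hm => by rw [HahnSeries.coeff_sub, coeff_nonnegPart, if_pos (by omega), sub_self]

theorem nonnegPart_eq_self {f : LaurentSeries ℂ} (hf : ∀ m > 0, f.coeff m = 0) :
    nonnegPart f = f := by
  ext m
  rw [coeff_nonnegPart]
  split_ifs with h
  · rfl
  · exact (hf m (by omega)).symm

theorem ddx_nonnegPart_eq_of_vanishBelow {f g : LaurentSeries ℂ} (h : VanishBelow 0 (f - g)) :
    ddx (nonnegPart f) = ddx (nonnegPart g) := by
  ext m
  rw [coeff_ddx, coeff_ddx, coeff_nonnegPart, coeff_nonnegPart]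
  rcases lt_trichotomy (m - 1) 0 with hm | hm | hm
  · rw [if_pos hm.le, if_pos hm.le, sub_eq_zero.1 (h _ hm)]
  · rw [hm, Int.cast_zero, zero_mul, zero_mul]
  · rw [if_neg (by omega), if_neg (by omega)]

theorem coeff_one_nonnegPart_mul_ddx_nonnegPart (f g : LaurentSeries ℂ) :
    (nonnegPart f * ddx (nonnegPart g)).coeff 1 = 0 := by
  rw [nonnegPart, nonnegPart, ddx_aeval_X, ← map_mul, coeff_aeval_X_of_pos _ one_pos]

/-- With `f = f₊ + f₋` and `g = g₊ + g₋`, the residues of `f₋ dg₋` and of `g₊ df₊` vanish, and so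
does that of `d(f₊ g₋)`. -/
theorem residue_mul_ddx_nonnegPart_sub (f g : LaurentSeries ℂ) :
    (f * ddx (nonnegPart g)).coeff 1 - (g * ddx (nonnegPart f)).coeff 1 =
      (f * ddx g).coeff 1 := by
  set fneg := f - nonnegPart f with hf
  set gneg := g - nonnegPart g with hg
  have hneg : (fneg * ddx gneg).coeff 1 = 0 :=
    (vanishBelow_sub_nonnegPart f).mul (vanishBelow_sub_nonnegPart g).ddx 1 (by norm_num)
  have hexact : (ddx (nonnegPart f * gneg)).coeff 1 = 0 := coeff_one_ddx _
  have hpos := coeff_one_nonnegPart_mul_ddx_nonnegPart g f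
  have hsplit : f * ddx g = f * ddx (nonnegPart g) - g * ddx (nonnegPart f) + (fneg * ddx gneg +
      (ddx (nonnegPart f * gneg) + nonnegPart g * ddx (nonnegPart f))) := by
    rw [ddx_mul, hf, hg, ddx_sub]
    ring
  rw [hsplit]
  simp only [HahnSeries.coeff_add, HahnSeries.coeff_sub, hneg, hexact, hpos, add_zero]

section Matrices

variable {n : ℕ} {Z V P Q M M' : Matrix (Fin n) (Fin n) (LaurentSeries ℂ)}

theorem map_ddx_mul : (M * M').map ddx = M.map ddx * M' + M * M'.map ddx := by
  ext1 i j
  simp only [Matrix.map_apply, Matrix.mul_apply, Matrix.add_apply, ddx_sum, ddx_mul,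
    Finset.sum_add_distrib]

theorem map_ddx_one : (1 : Matrix (Fin n) (Fin n) (LaurentSeries ℂ)).map ddx = 0 := by
  ext1 i j
  rw [Matrix.map_apply, Matrix.zero_apply,
    show (1 : Matrix (Fin n) (Fin n) (LaurentSeries ℂ)) i j = HahnSeries.C (if i = j then 1 else 0)
      by rw [Matrix.one_apply, apply_ite HahnSeries.C, map_one, map_zero], ddx_C]

theorem residue_trace_mul_ddx_nonnegPart_sub :
    (M * (M'.map nonnegPart).map ddx).trace.coeff 1 -
      (M' * (M.map nonnegPart).map ddx).trace.coeff 1 = (M * M'.map ddx).trace.coeff 1 := by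
  simp only [Matrix.trace, Matrix.diag, Matrix.mul_apply, HahnSeries.coeff_sum, Matrix.map_apply]
  rw [Finset.sum_comm (f := fun i j => (M' i j * ddx (nonnegPart (M j i))).coeff 1)]
  simp only [← Finset.sum_sub_distrib, residue_mul_ddx_nonnegPart_sub]

theorem map_ddx_conj (hVZ : V * Z = 1) :
    (V * Q * Z).map ddx = V * Q.map ddx * Z +
      (V * Q * Z * (V * Z.map ddx) - V * Z.map ddx * (V * Q * Z)) := by
  have hZV : Z * V = 1 := mul_eq_one_comm.1 hVZ
  have hd : V.map ddx = -(V * Z.map ddx * V) := by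
    have h : V.map ddx * Z + V * Z.map ddx = 0 := by rw [← map_ddx_mul, hVZ, map_ddx_one]
    rw [← mul_one (V.map ddx), ← hZV, ← mul_assoc, eq_neg_of_add_eq_zero_left h, Matrix.neg_mul]
  have hcancel : V * Q * Z * (V * Z.map ddx) = V * Q * Z.map ddx := by
    rw [mul_assoc (V * Q), ← mul_assoc Z, hZV, one_mul]
  rw [map_ddx_mul, map_ddx_mul, hd, hcancel]
  simp only [add_mul, Matrix.neg_mul, mul_assoc]
  abel

theorem conj_mul_conj (hVZ : V * Z = 1) : V * P * Z * (V * Q * Z) = V * (P * Q) * Z := by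
  rw [mul_assoc (V * P), mul_assoc V, ← mul_assoc Z, ← mul_assoc Z, mul_eq_one_comm.1 hVZ, one_mul]
  simp only [mul_assoc]

theorem trace_mul_mul_comm_of_mul_comm {ι R : Type*} [Fintype ι] [CommSemiring R]
    {P Q : Matrix ι ι R} (h : P * Q = Q * P) (M : Matrix ι ι R) :
    (P * (Q * M)).trace = (P * (M * Q)).trace := by
  rw [← mul_assoc, h, mul_assoc, Matrix.trace_mul_comm, mul_assoc]

/-- By `map_ddx_conj`, conjugation changes `dQ` by a commutator with `Q`, which is orthogonal to
the matrices commuting with `Q`. -/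
theorem trace_conj_mul_ddx_conj (hVZ : V * Z = 1) (hPQ : P * Q = Q * P) :
    ((V * P * Z) * (V * Q * Z).map ddx).trace = (P * Q.map ddx).trace := by
  have hcomm : V * P * Z * (V * Q * Z) = V * Q * Z * (V * P * Z) := by
    rw [conj_mul_conj hVZ, conj_mul_conj hVZ, hPQ]
  rw [map_ddx_conj hVZ, mul_add, Matrix.trace_add, mul_sub, Matrix.trace_sub,
    trace_mul_mul_comm_of_mul_comm hcomm, sub_self, add_zero, conj_mul_conj hVZ,
    Matrix.trace_mul_cycle, mul_eq_one_comm.1 hVZ, one_mul]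

theorem residue_trace_bareH_pow_mul_ddx [NeZero n] {J K : ℕ} (hJ : 1 ≤ J) (hK : 1 ≤ K) :
    (bareH n ^ K * (bareH n ^ J).map ddx).trace.coeff 1 = 0 := by
  have hpoly : ∀ J : ℕ, 1 ≤ J → ∀ i j, nonnegPart ((bareH n ^ J) i j) = (bareH n ^ J) i j := by
    intro J hJ i j
    refine nonnegPart_eq_self fun m hm => ?_
    rw [bareH_pow_eq_mulMat, coeff_mulMat, qPow, HahnSeries.coeff_single_of_ne]
    have := i.2
    nlinarith
  simp only [Matrix.trace, Matrix.diag, Matrix.mul_apply, HahnSeries.coeff_sum, Matrix.map_apply]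
  refine Finset.sum_eq_zero fun i _ => Finset.sum_eq_zero fun j _ => ?_
  rw [← hpoly J hJ, ← hpoly K hK, coeff_one_nonnegPart_mul_ddx_nonnegPart]

end Matrices

/-! ### Row eigenvectors of cyclic leading form -/

theorem exists_seq_of_local_step {α : Type*} (a₀ : α) (step : ℕ → (ℕ → α) → α)
    (hlocal : ∀ m a a', (∀ p ≤ m, a p = a' p) → step m a = step m a') :
    ∃ f : ℕ → α, f 0 = a₀ ∧ ∀ m, f (m + 1) = step m f := by
  let F (m : ℕ) (prev : ∀ p, p < m → α) : α :=
    match m with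
    | 0 => a₀
    | m + 1 => step m fun p => if h : p < m + 1 then prev p h else a₀
  have hfix := WellFounded.fix_eq Nat.lt_wfRel.wf F
  refine ⟨WellFounded.fix Nat.lt_wfRel.wf F, hfix 0, fun m => (hfix (m + 1)).trans ?_⟩
  exact hlocal m _ _ fun p hp => dif_pos (Nat.lt_succ_of_le hp)

section Cyclic

variable {n : ℕ} [NeZero n]

theorem ofNat_add_ofNat (a b : ℕ) : Fin.ofNat n a + Fin.ofNat n b = Fin.ofNat n (a + b) := by
  apply Fin.ext
  simp only [Fin.val_add, Fin.val_ofNat, ← Nat.add_mod]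

theorem ofNat_eq_zero {a : ℕ} (h : n ∣ a) : Fin.ofNat n a = 0 :=
  Fin.ext (Nat.mod_eq_zero_of_dvd h)

theorem eq_of_cyclic_invariant {α : Type*} {f : Fin n → α}
    (h : ∀ i, f (i + Fin.ofNat n 1) = f i) (i j : Fin n) : f i = f j := by
  have hzero : ∀ p : ℕ, f (Fin.ofNat n p) = f 0 := by
    intro p
    induction p with
    | zero => rfl
    | succ p ih => rw [← ofNat_add_ofNat, h, ih]
  rw [← Fin.ofNat_val_eq_self i, ← Fin.ofNat_val_eq_self j, hzero, hzero]

variable {k : Type*} [CommRing k]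

theorem sum_range_add_ofNat (g : Fin n → k) (i : Fin n) :
    ∑ m ∈ Finset.range n, g (i + Fin.ofNat n m) = ∑ l, g l := by
  rw [Finset.sum_range]
  simp only [Fin.ofNat_val_eq_self]
  exact Equiv.sum_comp (Equiv.addLeft i) g

theorem sum_mul_sub_sum_mul_shift (g : Fin n → k) (hg : ∑ l, g l = 0) (i : Fin n) :
    ∑ m ∈ Finset.range n, (m : k) * g (i + Fin.ofNat n m) -
      ∑ m ∈ Finset.range n, (m : k) * g (i + Fin.ofNat n 1 + Fin.ofNat n m) = -(n * g i) := by
  have hshift : ∀ m : ℕ, (m : k) * g (i + Fin.ofNat n 1 + Fin.ofNat n m) =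
      ((m + 1 : ℕ) : k) * g (i + Fin.ofNat n (m + 1)) - g (i + Fin.ofNat n 1 + Fin.ofNat n m) := by
    intro m
    rw [add_assoc, ofNat_add_ofNat, add_comm 1 m]
    push_cast
    ring
  have hwrap := Finset.sum_range_succ' (fun m : ℕ => (m : k) * g (i + Fin.ofNat n m)) n
  rw [Finset.sum_range_succ, ofNat_eq_zero dvd_rfl, add_zero, Nat.cast_zero, zero_mul,
    add_zero] at hwrap
  rw [Finset.sum_congr rfl fun m _ => hshift m, Finset.sum_sub_distrib, ← hwrap,
    sum_range_add_ofNat, hg]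
  ring

theorem exists_cyclic_difference (hn : IsUnit (n : k)) {τ : k} (hτ : IsUnit τ) (w : Fin n → k) :
    ∃ (v : Fin n → k) (e : k), ∀ i : Fin n,
      τ * v i - τ * v (i + Fin.ofNat n 1) + w (i + Fin.ofNat n 1) = e := by
  obtain ⟨c, hc⟩ := hn.exists_right_inv
  obtain ⟨σ, hσ⟩ := hτ.exists_right_inv
  set e : k := c * ∑ l, w l with he
  let g (i : Fin n) : k := w (i + Fin.ofNat n 1) - e
  have hg : ∑ l, g l = 0 := by
    have hw : ∑ i, w (i + Fin.ofNat n 1) = ∑ l, w l :=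
      Equiv.sum_comp (Equiv.addRight (Fin.ofNat n 1)) w
    rw [Finset.sum_sub_distrib, hw, Finset.sum_const, Finset.card_univ, Fintype.card_fin,
      nsmul_eq_mul, he, ← mul_assoc, hc, one_mul, sub_self]
  refine ⟨fun i => σ * (c * ∑ m ∈ Finset.range n, (m : k) * g (i + Fin.ofNat n m)), e,
    fun i => ?_⟩
  linear_combination (τ * σ * c) * sum_mul_sub_sum_mul_shift g hg i - (n * c * g i) * hσ -
    g i * hc

theorem vecMul_cyclic {τ : k} {B : Matrix (Fin n) (Fin n) k}
    (hB : ∀ i j, B i j = if i + Fin.ofNat n 1 = j then τ else 0) (v : Fin n → k) (i : Fin n) :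
    Matrix.vecMul v B (i + Fin.ofNat n 1) = τ * v i := by
  simp [Matrix.vecMul, dotProduct, hB, mul_comm]

theorem exists_eigenrow_coeff (hn : IsUnit (n : k)) {τ : k} (hτ : IsUnit τ)
    (b : ℕ → Matrix (Fin n) (Fin n) k) :
    ∃ (v : ℕ → Fin n → k) (e : ℕ → k), v 0 = 1 ∧ e 0 = τ ∧ ∀ m i,
      τ * v (m + 1) i - τ * v (m + 1) (i + Fin.ofNat n 1) +
        (∑ p ∈ Finset.range (m + 1), Matrix.vecMul (v p) (b (m + 1 - p)) -
          ∑ p ∈ Finset.range m, e (p + 1) • v (m - p)) (i + Fin.ofNat n 1) = e (m + 1) := by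
  choose V E hVE using exists_cyclic_difference hn hτ
  let w (m : ℕ) (a : ℕ → (Fin n → k) × k) : Fin n → k :=
    ∑ p ∈ Finset.range (m + 1), Matrix.vecMul (a p).1 (b (m + 1 - p)) -
      ∑ p ∈ Finset.range m, (a (p + 1)).2 • (a (m - p)).1
  have hw : ∀ m a a', (∀ p ≤ m, a p = a' p) → w m a = w m a' := by
    refine fun m a a' h => congrArg₂ (· - ·) (Finset.sum_congr rfl fun p hp => ?_)
      (Finset.sum_congr rfl fun p hp => ?_)
    all_goals rw [Finset.mem_range] at hp
    · rw [h p (by omega)]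
    · rw [h (p + 1) (by omega), h (m - p) (by omega)]
  obtain ⟨f, hf₀, hf⟩ := exists_seq_of_local_step (1, τ) (fun m a => (V (w m a), E (w m a)))
    fun m a a' h => by rw [hw m a a' h]
  refine ⟨fun m => (f m).1, fun m => (f m).2, congrArg Prod.fst hf₀, congrArg Prod.snd hf₀,
    fun m i => ?_⟩
  have hm := hVE (w m f) i
  rwa [show V (w m f) = (f (m + 1)).1 by rw [hf], show E (w m f) = (f (m + 1)).2 by rw [hf]] at hm

/-- At each order, the next coefficients of the eigenrow and of the eigenvalue solve a cyclic
difference equation. -/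
theorem exists_eigenrow_powerSeries (hn : IsUnit (n : k)) {τ : k} (hτ : IsUnit τ)
    (b : Matrix (Fin n) (Fin n) (PowerSeries k))
    (hb : ∀ i j, PowerSeries.coeff 0 (b i j) = if i + Fin.ofNat n 1 = j then τ else 0) :
    ∃ (l : Fin n → PowerSeries k) (e : PowerSeries k), Matrix.vecMul l b = e • l ∧
      ∀ j, PowerSeries.coeff 0 (l j) = 1 := by
  obtain ⟨v, e, hv₀, he₀, hstep⟩ :=
    exists_eigenrow_coeff hn hτ fun p => b.map (PowerSeries.coeff p)
  refine ⟨fun j => PowerSeries.mk fun m => v m j, PowerSeries.mk e, ?_, fun j => by simp [hv₀]⟩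
  ext1 j
  obtain ⟨i, rfl⟩ : ∃ i, i + Fin.ofNat n 1 = j := ⟨j - Fin.ofNat n 1, by simp⟩
  ext m
  have hexpand : PowerSeries.coeff m (Matrix.vecMul (fun j => PowerSeries.mk fun m => v m j) b
      (i + Fin.ofNat n 1)) = (∑ p ∈ Finset.range (m + 1),
        Matrix.vecMul (v p) (b.map (PowerSeries.coeff (m - p)))) (i + Fin.ofNat n 1) := by
    simp only [Matrix.vecMul, dotProduct, map_sum, PowerSeries.coeff_mul, PowerSeries.coeff_mk,
      Finset.Nat.sum_antidiagonal_eq_sum_range_succ_mk, Finset.sum_apply, Matrix.map_apply]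
    exact Finset.sum_comm
  rw [hexpand, Pi.smul_apply, smul_eq_mul, PowerSeries.coeff_mul,
    Finset.Nat.sum_antidiagonal_eq_sum_range_succ_mk, Finset.sum_range_succ, Pi.add_apply,
    Nat.sub_self, vecMul_cyclic (B := b.map (PowerSeries.coeff 0)) hb]
  simp only [PowerSeries.coeff_mk]
  cases m with
  | zero => simp [hv₀, he₀]
  | succ m =>
    have hm := hstep m i
    simp only [Pi.sub_apply, Finset.sum_apply, Pi.smul_apply, smul_eq_mul] at hm ⊢
    rw [Nat.succ_eq_add_one, Finset.sum_range_succ (fun p => e p * _) (m + 1),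
      Finset.sum_range_succ' (fun p => e p * _) m]
    simp only [hv₀, he₀, Nat.sub_self, Nat.sub_zero, Nat.add_sub_add_right, Pi.one_apply]
    linear_combination hm

omit [NeZero n] in
theorem eq_single_smul_one_add_of_coeff {τ : k} {N : ℤ}
    {B : Matrix (Fin n) (Fin n) (LaurentSeries k)} (hB : ∀ i j, VanishBelow N (B i j))
    (hB₀ : ∀ i j, (B i j).coeff N = if i = j then τ else 0) :
    B = (HahnSeries.single N τ : LaurentSeries k) • (1 : Matrix _ _ (LaurentSeries k)) +
      (HahnSeries.single (N + 1) 1 : LaurentSeries k) •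
        (Matrix.of fun i j => PowerSeries.mk fun p => (B i j).coeff (N + 1 + p)).map
          (HahnSeries.ofPowerSeries ℤ k) := by
  ext i j m
  have hscalar : ((HahnSeries.single N τ : LaurentSeries k) •
      (1 : Matrix (Fin n) (Fin n) (LaurentSeries k))) i j =
        HahnSeries.single N (if i = j then τ else 0) := by
    rw [Matrix.smul_apply, smul_eq_mul, Matrix.one_apply]
    split_ifs <;> simp
  rw [Matrix.add_apply, hscalar, ← hB₀, HahnSeries.coeff_add, Matrix.smul_apply, smul_eq_mul,
    HahnSeries.coeff_single_mul, one_mul, Matrix.map_apply, PowerSeries.coeff_coe,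
    HahnSeries.coeff_single, Matrix.of_apply, PowerSeries.coeff_mk]
  rcases lt_trichotomy m N with h | rfl | h
  · rw [if_neg h.ne, if_pos (by omega), hB i j m h, add_zero]
  · simp
  · rw [if_neg h.ne', if_neg (by omega), zero_add]
    congr 1
    omega

/-- `B = τ' q^(-N) + τ q^(-N-1) C + O(q^(-N-2))`, with `C` a cyclic permutation matrix: the form
of the sheared matrix of a gauge-fixed connection. -/
structure IsCyclicLeading (B : Matrix (Fin n) (Fin n) (LaurentSeries k)) (N : ℤ) (τ' τ : k) :
    Prop where
  vanishBelow : ∀ i j, VanishBelow N (B i j)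
  coeff_first : ∀ i j, (B i j).coeff N = if i = j then τ' else 0
  coeff_second : ∀ i j, (B i j).coeff (N + 1) = if i + Fin.ofNat n 1 = j then τ else 0

/-- A row eigenvector `l = (1, …, 1) + O(1/q)` of `B`, with eigenvalue `y`. -/
structure IsEigenrow (B : Matrix (Fin n) (Fin n) (LaurentSeries k)) (l : Fin n → LaurentSeries k)
    (y : LaurentSeries k) : Prop where
  eigen : Matrix.vecMul l B = y • l
  integral : ∀ j, VanishBelow 0 (l j)
  coeff_zero : ∀ j, (l j).coeff 0 = 1

theorem IsCyclicLeading.exists_isEigenrow (hn : IsUnit (n : k)) {τ τ' : k} (hτ : IsUnit τ) {N : ℤ}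
    {B : Matrix (Fin n) (Fin n) (LaurentSeries k)} (hB : IsCyclicLeading B N τ' τ) :
    ∃ l y, IsEigenrow B l y := by
  let ι := HahnSeries.ofPowerSeries ℤ k
  obtain ⟨l, e, hle, hl⟩ := exists_eigenrow_powerSeries hn hτ
    (Matrix.of fun i j => PowerSeries.mk fun p => (B i j).coeff (N + 1 + p)) fun i j => by
      rw [Matrix.of_apply, PowerSeries.coeff_mk, Nat.cast_zero, add_zero, hB.coeff_second]
  refine ⟨ι ∘ l, HahnSeries.single N τ' + HahnSeries.single (N + 1) 1 * ι e, ?_,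
    fun j => VanishBelow.ofPowerSeries _, fun j => ?_⟩
  · have hι := congrArg (ι ∘ ·) hle
    have hsmul : ι ∘ (e • l) = ι e • (ι ∘ l) := funext fun j => map_mul ι e (l j)
    have hvecMul := funext (RingHom.map_vecMul ι (Matrix.of fun i j =>
      PowerSeries.mk fun p => (B i j).coeff (N + 1 + p)) l)
    rw [hsmul] at hι
    replace hι := hvecMul.symm.trans hι
    rw [eq_single_smul_one_add_of_coeff hB.vanishBelow hB.coeff_first,
      Matrix.vecMul_add, Matrix.vecMul_smul, Matrix.vecMul_smul, Matrix.vecMul_one, hι, add_smul,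
      mul_smul]
  · rw [Function.comp_apply, PowerSeries.coeff_coe]
    simpa using hl j

section Uniqueness

variable {k : Type*}

omit [NeZero n] in
theorem dotProduct_eq_zero_of_eigenvalue_ne [CommRing k] [NoZeroDivisors k]
    {B : Matrix (Fin n) (Fin n) (LaurentSeries k)}
    {l u : Fin n → LaurentSeries k} {y y' : LaurentSeries k} (hl : Matrix.vecMul l B = y • l)
    (hu : B.mulVec u = y' • u) (hne : y' ≠ y) : l ⬝ᵥ u = 0 := by
  have h : y * (l ⬝ᵥ u) = y' * (l ⬝ᵥ u) := calc
    y * (l ⬝ᵥ u) = Matrix.vecMul l B ⬝ᵥ u := by rw [hl, smul_dotProduct, smul_eq_mul]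
    _ = y' * (l ⬝ᵥ u) := by rw [← Matrix.dotProduct_mulVec, hu, dotProduct_smul, smul_eq_mul]
  rw [← sub_eq_zero, ← sub_mul, mul_eq_zero, sub_eq_zero] at h
  exact h.resolve_left hne.symm

theorem eq_zero_of_vanishBelow_succ [Zero k] {u : Fin n → LaurentSeries k}
    (h : ∀ m, (∀ i, VanishBelow m (u i)) → ∀ i, VanishBelow (m + 1) (u i)) : u = 0 := by
  obtain ⟨i₀, hi₀⟩ := Finite.exists_min fun i => (u i).order
  have hall : ∀ m : ℕ, ∀ i, VanishBelow ((u i₀).order + m) (u i) := by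
    intro m
    induction m with
    | zero =>
      intro i p hp
      rw [Nat.cast_zero, add_zero] at hp
      exact HahnSeries.coeff_eq_zero_of_lt_order (hp.trans_le (hi₀ i))
    | succ m ih => exact fun i => by simpa [add_assoc] using h _ ih i
  ext i p
  exact hall (p - (u i₀).order + 1).toNat i p (by omega)

variable [CommRing k] [NoZeroDivisors k] {B : Matrix (Fin n) (Fin n) (LaurentSeries k)} {N : ℤ}
  {τ τ' : k} {u : Fin n → LaurentSeries k} {y y' : LaurentSeries k}

theorem IsCyclicLeading.coeff_add_one_eq (hB : IsCyclicLeading B N τ' τ) (hτ : τ ≠ 0)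
    (hy : VanishBelow N y) (hy₀ : y.coeff N = τ') (hy₁ : y.coeff (N + 1) = τ)
    (hBu : B.mulVec u = y • u) {m : ℤ} (hu : ∀ i, VanishBelow m (u i)) (i : Fin n) :
    (u (i + Fin.ofNat n 1)).coeff m = (u i).coeff m := by
  have hi := congrArg (fun f => f.coeff (N + m + 1)) (congrFun hBu i)
  have hterm : ∀ j, (B i j * u j).coeff (N + m + 1) =
      (if i = j then τ' * (u j).coeff (m + 1) else 0) +
        if i + Fin.ofNat n 1 = j then τ * (u j).coeff m else 0 := fun j => by
    rw [(hB.vanishBelow i j).coeff_mul_add_one (hu j), hB.coeff_first, hB.coeff_second, ite_mul,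
      ite_mul, zero_mul, zero_mul]
  simp only [Matrix.mulVec, dotProduct, HahnSeries.coeff_sum, hterm, Finset.sum_add_distrib,
    Finset.sum_ite_eq, Finset.mem_univ, if_true, Pi.smul_apply, smul_eq_mul] at hi
  rw [hy.coeff_mul_add_one (hu i), hy₀, hy₁] at hi
  exact mul_left_cancel₀ hτ (add_left_cancel hi)

/-- A right eigenvector for another eigenvalue would have a constant leading vector, against its
orthogonality to `(1, …, 1) + O(1/q)`. -/
theorem IsCyclicLeading.eigenvalue_eq (hB : IsCyclicLeading B N τ' τ) (hn : (n : k) ≠ 0)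
    (hτ : τ ≠ 0) {l : Fin n → LaurentSeries k} (hl : IsEigenrow B l y) (hy : VanishBelow N y')
    (hy₀ : y'.coeff N = τ') (hy₁ : y'.coeff (N + 1) = τ) (hu : u ≠ 0)
    (hBu : B.mulVec u = y' • u) : y' = y := by
  by_contra hne
  have horth := dotProduct_eq_zero_of_eigenvalue_ne hl.eigen hBu hne
  refine hu (eq_zero_of_vanishBelow_succ fun m hm i p hp => ?_)
  have hconst := eq_of_cyclic_invariant (f := fun i => (u i).coeff m)
    (hB.coeff_add_one_eq hτ hy hy₀ hy₁ hBu hm)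
  have hterm : ∀ j, (l j * u j).coeff m = (u i).coeff m := fun j => by
    rw [← zero_add m, (hl.integral j).coeff_mul (hm j), hl.coeff_zero, one_mul, zero_add]
    exact hconst j i
  have hsum := congrArg (fun f => f.coeff m) horth
  simp only [dotProduct, HahnSeries.coeff_sum, HahnSeries.coeff_zero, hterm, Finset.sum_const,
    Finset.card_univ, Fintype.card_fin, nsmul_eq_mul, mul_eq_zero] at hsum
  rcases lt_or_eq_of_le (show p ≤ m by omega) with hlt | rfl
  · exact hm i p hlt
  · exact hsum.resolve_left hn

end Uniqueness

end Cyclic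

section Rigidity

variable {n M : ℕ} [NeZero n] {k : Type*} [CommRing k] [NoZeroDivisors k] {c : ℕ → k}
  {ω : Fin n → LaurentSeries k} {y : LaurentSeries k}

/-- Averaging over the cyclic group replaces each shift of `ω` by the mean of `ω`, whose leading
coefficient is invertible. -/
theorem vanishBelow_eigenvalue_sub (s : Finset ℕ) (hn : (n : k) ≠ 0)
    (hω : ∀ j, VanishBelow 0 (ω j)) (hω₀ : ∀ j, (ω j).coeff 0 = 1)
    (h : ∀ j, VanishBelow n (y * ω j -
      ∑ J ∈ s, HahnSeries.single ((n : ℤ) - J) (c J) * ω (j + Fin.ofNat n J))) :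
    VanishBelow n (y - ∑ J ∈ s, HahnSeries.single ((n : ℤ) - J) (c J)) := by
  have hmean : ∀ J : ℕ, ∑ j, HahnSeries.single ((n : ℤ) - J) (c J) * ω (j + Fin.ofNat n J) =
      HahnSeries.single ((n : ℤ) - J) (c J) * ∑ j, ω j := fun J => by
    rw [← Finset.mul_sum]
    exact congrArg _ (Equiv.sum_comp (Equiv.addRight (Fin.ofNat n J)) ω)
  refine VanishBelow.of_mul_right (g := ∑ j, ω j) (VanishBelow.sum fun j _ => hω j) ?_ ?_
  · rw [HahnSeries.coeff_sum, Finset.sum_congr rfl fun j _ => hω₀ j]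
    simpa using hn
  · have hsum := VanishBelow.sum fun j (_ : j ∈ Finset.univ) => h j
    rwa [Finset.sum_sub_distrib, Finset.sum_comm, ← Finset.mul_sum,
      Finset.sum_congr rfl fun J _ => hmean J, ← Finset.sum_mul, ← sub_mul] at hsum

theorem vanishBelow_sub_of_cyclic (hM : n ∣ M + 1) (hc : c M ≠ 0)
    (hω : ∀ j, VanishBelow 0 (ω j))
    (h : ∀ j, VanishBelow n (∑ J ∈ Finset.range (M + 2),
      HahnSeries.single ((n : ℤ) - J) (c J) * (ω j - ω (j + Fin.ofNat n J)))) (i j : Fin n) :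
    VanishBelow M (ω i - ω j) := by
  suffices H : ∀ m : ℕ, m ≤ M → ∀ i j, VanishBelow m (ω i - ω j) from H M le_rfl i j
  intro m
  induction m with
  | zero => exact fun _ i j => (hω i).sub (hω j)
  | succ m ih =>
    intro hm
    replace ih := ih (by omega)
    have hcoeff : ∀ j, (ω j - ω (j + Fin.ofNat n M)).coeff m = 0 := by
      intro j
      have hj := h j (n - M + m) (by omega)
      rw [Finset.sum_range_succ, ofNat_eq_zero hM, add_zero, sub_self, mul_zero, add_zero,
        Finset.sum_range_succ, HahnSeries.coeff_add, HahnSeries.coeff_sum,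
        Finset.sum_eq_zero, zero_add, HahnSeries.coeff_single_mul, add_sub_cancel_left] at hj
      · exact (mul_eq_zero.1 hj).resolve_left hc
      · intro J hJ
        rw [Finset.mem_range] at hJ
        rw [HahnSeries.coeff_single_mul, ih _ _ _ (by omega), mul_zero]
    have hinv : ∀ i, (ω (i + Fin.ofNat n 1)).coeff (m : ℤ) = (ω i).coeff (m : ℤ) := by
      intro i
      have hi := hcoeff (i + Fin.ofNat n 1)
      rwa [add_assoc, ofNat_add_ofNat, add_comm 1 M, ofNat_eq_zero hM, add_zero,
        HahnSeries.coeff_sub, sub_eq_zero] at hi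
    intro i j p hp
    rcases lt_or_eq_of_le (show p ≤ m by omega) with hlt | rfl
    · exact ih i j p hlt
    · rw [HahnSeries.coeff_sub, sub_eq_zero]
      exact eq_of_cyclic_invariant (f := fun i => (ω i).coeff (m : ℤ)) hinv i j

theorem vanishBelow_sub_of_approx_eigenrow (hn : (n : k) ≠ 0) (hM : n ∣ M + 1) (hc : c M ≠ 0)
    (hω : ∀ j, VanishBelow 0 (ω j)) (hω₀ : ∀ j, (ω j).coeff 0 = 1)
    (h : ∀ j, VanishBelow n (y * ω j - ∑ J ∈ Finset.range (M + 2),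
      HahnSeries.single ((n : ℤ) - J) (c J) * ω (j + Fin.ofNat n J))) (i j : Fin n) :
    VanishBelow M (ω i - ω j) := by
  refine vanishBelow_sub_of_cyclic hM hc hω (fun j => ?_) i j
  have hy := (vanishBelow_eigenvalue_sub _ hn hω hω₀ h).mul (hω j)
  rw [add_zero] at hy
  have hj := (h j).sub hy
  rwa [sub_mul, sub_sub_sub_cancel_left, Finset.sum_mul, ← Finset.sum_sub_distrib,
    Finset.sum_congr rfl fun J _ => (mul_sub _ _ _).symm] at hj

end Rigidity

/-! ### Unipotent matrices -/

section Unipotent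

variable {n : ℕ}

theorem vanishBelow_matrix_mul {k : Type*} [CommRing k]
    {M M' : Matrix (Fin n) (Fin n) (LaurentSeries k)} {a b : ℤ} (h : ∀ i j, VanishBelow a (M i j))
    (h' : ∀ i j, VanishBelow b (M' i j)) (i j : Fin n) : VanishBelow (a + b) ((M * M') i j) := by
  rw [Matrix.mul_apply]
  exact VanishBelow.sum fun l _ => (h i l).mul (h' l j)

theorem exists_integral_inverse {k : Type*} [CommRing k]
    {M : Matrix (Fin n) (Fin n) (LaurentSeries k)} (hM : ∀ i j, VanishBelow 0 (M i j))
    (hM₀ : ∀ i j, (M i j).coeff 0 = (1 : Matrix (Fin n) (Fin n) k) i j) :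
    ∃ V : Matrix (Fin n) (Fin n) (LaurentSeries k), V * M = 1 ∧ ∀ i j, VanishBelow 0 (V i j) := by
  set P : Matrix (Fin n) (Fin n) (PowerSeries k) :=
    Matrix.of fun i j => PowerSeries.mk fun p => (M i j).coeff p with hP
  have hMP : M = P.map (HahnSeries.ofPowerSeries ℤ k) := by
    ext1 i j
    simpa [hP] using (hM i j).eq_single_mul
  have hP₀ : (PowerSeries.constantCoeff (R := k)).mapMatrix P = 1 := by
    ext1 i j
    rw [← hM₀, hP, RingHom.mapMatrix_apply, Matrix.map_apply, Matrix.of_apply,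
      ← PowerSeries.coeff_zero_eq_constantCoeff_apply, PowerSeries.coeff_mk, Nat.cast_zero]
  have hdet : IsUnit P.det := by
    rw [PowerSeries.isUnit_iff_constantCoeff, RingHom.map_det, hP₀, Matrix.det_one]
    exact isUnit_one
  refine ⟨P⁻¹.map (HahnSeries.ofPowerSeries ℤ k), ?_, fun i j => VanishBelow.ofPowerSeries _⟩
  rw [hMP, ← Matrix.map_mul, Matrix.nonsing_inv_mul _ hdet]
  exact Matrix.map_one _ (map_zero _) (map_one _)

variable [NeZero n] {M M' : Matrix (Fin n) (Fin n) (LaurentSeries ℂ)}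

theorem coeff_zero_shear (M : Matrix (Fin n) (Fin n) (LaurentSeries ℂ)) (i j : Fin n) :
    (shear M i j).coeff 0 = if i = j then (M i j).coeff 0 else 0 := by
  rcases eq_or_ne i j with rfl | h
  · simpa using coeff_shear M i i 0
  · simpa [h] using coeff_shear_of_ne M h j 0

theorem vanishBelow_of_shear {i j : Fin n} (h : VanishBelow 0 (shear M i j)) :
    VanishBelow 0 (M i j) := fun k hk => by
  rw [← coeff_shear]
  refine h _ ?_
  have := j.2
  nlinarith

/-- The sheared matrix is congruent to the identity modulo `1/q`. -/
structure IsUnipotent (M : Matrix (Fin n) (Fin n) (LaurentSeries ℂ)) : Prop where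
  integral : ∀ i j, VanishBelow 0 (shear M i j)
  coeff_zero : ∀ i j, (shear M i j).coeff 0 = (1 : Matrix (Fin n) (Fin n) ℂ) i j

namespace IsUnipotent

theorem mul (h : IsUnipotent M) (h' : IsUnipotent M') : IsUnipotent (M * M') where
  integral i j := by
    rw [map_mul]
    exact vanishBelow_matrix_mul h.integral h'.integral i j
  coeff_zero i j := by
    rw [map_mul, Matrix.mul_apply, HahnSeries.coeff_sum, ← mul_one (1 : Matrix _ _ ℂ),
      Matrix.mul_apply]
    refine Finset.sum_congr rfl fun l _ => ?_
    rw [← h.coeff_zero, ← h'.coeff_zero, ← (h.integral i l).coeff_mul (h'.integral l j), add_zero]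

theorem vanishBelow_colSum (h : IsUnipotent M) (j : Fin n) : VanishBelow 0 (colSum M j) := by
  rw [colSum_apply]
  exact VanishBelow.sum fun i _ => h.integral i j

theorem coeff_zero_colSum (h : IsUnipotent M) (j : Fin n) : (colSum M j).coeff 0 = 1 := by
  simp [colSum_apply, HahnSeries.coeff_sum, h.coeff_zero, Matrix.one_apply]

theorem isUnit_det (h : IsUnipotent M) : IsUnit M.det := by
  obtain ⟨V, hV, -⟩ := exists_integral_inverse h.integral h.coeff_zero
  refine isUnit_iff_ne_zero.2 fun hzero => ?_
  have hdet := congrArg Matrix.det hV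
  rw [Matrix.det_mul, det_shear, hzero, map_zero, mul_zero, Matrix.det_one] at hdet
  exact zero_ne_one hdet

theorem integral_inv (h : IsUnipotent M) (i j : Fin n) : VanishBelow 0 (shear M⁻¹ i j) := by
  obtain ⟨V, hV, hV'⟩ := exists_integral_inverse h.integral h.coeff_zero
  have hinv : shear M * shear M⁻¹ = 1 := by
    rw [← map_mul, Matrix.mul_nonsing_inv _ h.isUnit_det, map_one]
  rw [← left_inv_eq_right_inv hV hinv]
  exact hV' i j

theorem unshear {u : Fin n → LaurentSeries ℂ} (hu : ∀ j, VanishBelow 0 (u j))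
    (hu₀ : ∀ j, (u j).coeff 0 = 1) : IsUnipotent (unshear u) where
  integral := vanishBelow_shear fun j => by rw [colSum_unshear]; exact hu j
  coeff_zero i j := by
    rw [coeff_zero_shear, Matrix.one_apply]
    split_ifs with h
    · subst h
      rw [← coeff_colSum, colSum_unshear]
      simpa using hu₀ i
    · rfl

theorem of_isNormalized (hM : ∀ i j m, m < 0 → (M i j).coeff m = 0) (hN : IsNormalized M) :
    IsUnipotent M where
  integral i j m hm := by
    obtain ⟨i', k, rfl⟩ := exists_index j m
    rcases eq_or_ne i i' with rfl | h
    · rw [coeff_shear]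
      rcases lt_trichotomy k 0 with hk | rfl | hk
      · exact hM _ _ _ hk
      · have hji : j < i := Fin.lt_def.2 (by omega)
        exact (hN i j hji.le).trans (Matrix.one_apply_ne hji.ne')
      · have hi := i.2
        nlinarith
    · exact coeff_shear_of_ne M h j k
  coeff_zero i j := by
    rw [coeff_zero_shear]
    split_ifs with h
    · subst h
      exact hN i i le_rfl
    · rw [Matrix.one_apply_ne h]

end IsUnipotent

end Unipotent

/-! ### Matrices commuting with a triangular Toeplitz matrix -/

section Toeplitz

variable {n : ℕ} {R : Type*} [CommRing R] {τ : ℕ → R} {T Y : Matrix (Fin n) (Fin n) R}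

theorem toeplitz_mul_apply (hT : ∀ i j : Fin n, T i j = if i ≤ j then τ ((j : ℕ) - i) else 0)
    {p q j : Fin n} (hq : (q : ℕ) = p + 1) (hY : ∀ l, q < l → Y l j = 0) :
    (T * Y) p j = τ 0 * Y p j + τ 1 * Y q j := by
  have hpq : p ≠ q := fun h => by rw [h] at hq; omega
  rw [Matrix.mul_apply, Fintype.sum_eq_add p q hpq]
  · rw [hT, hT, if_pos le_rfl, if_pos (Fin.le_def.2 (by omega)), Nat.sub_self, hq,
      Nat.add_sub_cancel_left]
  · rintro l ⟨hlp, hlq⟩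
    rcases lt_or_gt_of_ne hlq with hlt | hgt
    · rw [hT, if_neg, zero_mul]
      rw [Fin.le_def]
      rw [Fin.lt_def] at hlt
      rw [Ne, Fin.ext_iff] at hlp
      omega
    · rw [hY l hgt, mul_zero]

theorem mul_toeplitz_apply (hT : ∀ i j : Fin n, T i j = if i ≤ j then τ ((j : ℕ) - i) else 0)
    {p j' j : Fin n} (hj : (j : ℕ) = j' + 1) (hY : ∀ l, l < j' → Y p l = 0) :
    (Y * T) p j = τ 1 * Y p j' + τ 0 * Y p j := by
  have hjj : j' ≠ j := fun h => by rw [h] at hj; omega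
  rw [Matrix.mul_apply, Fintype.sum_eq_add j' j hjj]
  · rw [hT, hT, if_pos le_rfl, if_pos (Fin.le_def.2 (by omega)), Nat.sub_self, hj,
      Nat.add_sub_cancel_left, mul_comm, mul_comm (Y p j)]
  · rintro l ⟨hlj', hlj⟩
    rcases lt_or_gt_of_ne hlj' with hlt | hgt
    · rw [hY l hlt, zero_mul]
    · rw [hT, if_neg, mul_zero]
      rw [Fin.le_def]
      rw [Fin.lt_def] at hgt
      rw [Ne, Fin.ext_iff] at hlj
      omega

variable [NoZeroDivisors R] {d : ℕ}

theorem eq_of_commute_toeplitz (hτ : τ 1 ≠ 0)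
    (hT : ∀ i j : Fin n, T i j = if i ≤ j then τ ((j : ℕ) - i) else 0) (hTY : T * Y = Y * T)
    (hY : ∀ i j : Fin n, (j : ℕ) + d < i → Y i j = 0) {p q j' j : Fin n} (hq : (q : ℕ) = p + 1)
    (hj : (j : ℕ) = j' + 1) (hd : (q : ℕ) = j + d) : Y q j = Y p j' := by
  have hentry := congrFun (congrFun hTY p) j
  rw [toeplitz_mul_apply hT hq fun l hl => hY l j (by rw [Fin.lt_def] at hl; omega),
    mul_toeplitz_apply hT hj fun l hl => hY p l (by rw [Fin.lt_def] at hl; omega)] at hentry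
  exact mul_left_cancel₀ hτ (by linear_combination hentry)

theorem eq_zero_of_commute_toeplitz (hτ : τ 1 ≠ 0)
    (hT : ∀ i j : Fin n, T i j = if i ≤ j then τ ((j : ℕ) - i) else 0) (hTY : T * Y = Y * T)
    (hY : ∀ i j : Fin n, (j : ℕ) + d < i → Y i j = 0) {p q j : Fin n} (hq : (q : ℕ) = p + 1)
    (hj : (j : ℕ) = 0) (hd : (q : ℕ) = d) : Y q j = 0 := by
  have hentry := congrFun (congrFun hTY p) j
  have hYT : (Y * T) p j = Y p j * τ 0 := by
    rw [Matrix.mul_apply, Fintype.sum_eq_single j, hT, if_pos le_rfl, Nat.sub_self]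
    intro l hl
    rw [hT, if_neg, mul_zero]
    rw [Fin.le_def]
    rw [Ne, Fin.ext_iff] at hl
    omega
  rw [toeplitz_mul_apply hT hq fun l hl => hY l j (by rw [Fin.lt_def] at hl; omega), hYT] at hentry
  exact (mul_eq_zero.1 (by linear_combination hentry)).resolve_left hτ

/-- Commutation with `T` makes the lowest nonvanishing subdiagonal of `Y` constant, and zero
unless it is the diagonal. -/
theorem lower_eq_zero_of_commute_toeplitz (hτ : τ 1 ≠ 0)
    (hT : ∀ i j : Fin n, T i j = if i ≤ j then τ ((j : ℕ) - i) else 0) (hTY : T * Y = Y * T)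
    {i j : Fin n} (hij : j < i) : Y i j = 0 := by
  suffices H : ∀ d ≤ n, ∀ i j : Fin n, (j : ℕ) + d < i → Y i j = 0 from H 0 (Nat.zero_le n) i j hij
  intro d hd
  induction hd using Nat.decreasingInduction with
  | self => exact fun i j h => absurd i.2 (by omega)
  | of_succ d hd ih =>
    have hsub : ∀ (m : ℕ) (i j : Fin n), (j : ℕ) = m → (i : ℕ) = j + (d + 1) → Y i j = 0 := by
      intro m
      induction m with
      | zero =>
        exact fun i j hj hi => eq_zero_of_commute_toeplitz hτ hT hTY ih (p := ⟨d, hd⟩) (d := d + 1)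
          (by rw [hi, hj, zero_add]) hj (by omega)
      | succ m ihm =>
        intro i j hj hi
        rw [eq_of_commute_toeplitz hτ hT hTY ih (p := ⟨m + (d + 1), by omega⟩)
          (j' := ⟨m, by omega⟩) (by rw [hi, hj]; ring) hj hi]
        exact ihm _ _ rfl rfl
    intro i j h
    rcases (Nat.succ_le_of_lt h).eq_or_lt with heq | hlt
    · exact hsub j i j rfl (by omega)
    · exact ih i j (by omega)

theorem diag_eq_of_commute_toeplitz [NeZero n] (hτ : τ 1 ≠ 0)
    (hT : ∀ i j : Fin n, T i j = if i ≤ j then τ ((j : ℕ) - i) else 0) (hTY : T * Y = Y * T)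
    (i : Fin n) : Y i i = Y 0 0 := by
  obtain ⟨m, hm⟩ := i
  induction m with
  | zero => rfl
  | succ m ih =>
    rw [← ih (by omega)]
    exact eq_of_commute_toeplitz (d := 0) hτ hT hTY
      (fun i j h => lower_eq_zero_of_commute_toeplitz hτ hT hTY (Fin.lt_def.2 (by omega))) rfl rfl
      rfl

end Toeplitz

/-! ### The bare connection and the normalized gauge -/

section BareConnection

variable {n : ℕ} [NeZero n] {N : ℕ}

/-- The coefficient of `𝓗 ^ J` in `x D(x)`. -/
def bareCoeff (n : ℕ) {N : ℕ} (t₀ : ℂ) (t : Fin N → ℂ) (J : ℕ) : ℂ :=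
  (if J = 0 then t₀ else time t J) / n

theorem colSum_smul (f : LaurentSeries ℂ) (M : Matrix (Fin n) (Fin n) (LaurentSeries ℂ))
    (j : Fin n) : colSum (f • M) j = expandHom n f * colSum M j := by
  simp only [colSum_apply, shear_apply, Matrix.smul_apply, smul_eq_mul, map_mul, Finset.mul_sum,
    mul_left_comm]

omit [NeZero n] in
theorem mul_laurent_smul (f : LaurentSeries ℂ) (M M' : Matrix (Fin n) (Fin n) (LaurentSeries ℂ)) :
    M * (f • M') = f • (M * M') :=
  Matrix.mul_smul M f M'

omit [NeZero n] in
theorem laurent_smul_mul (f : LaurentSeries ℂ) (M M' : Matrix (Fin n) (Fin n) (LaurentSeries ℂ)) :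
    (f • M) * M' = f • (M * M') :=
  Matrix.smul_mul f M M'

omit [NeZero n] in
theorem smul_eq_C_smul (c : ℂ) (M : Matrix (Fin n) (Fin n) (LaurentSeries ℂ)) :
    c • M = (HahnSeries.C c : LaurentSeries ℂ) • M := by
  ext i j m
  simp

theorem inv_natCast_mul_X : ((n : LaurentSeries ℂ) * X)⁻¹ = HahnSeries.single 1 (1 / (n : ℂ)) := by
  have hn : (n : ℂ) ≠ 0 := NeZero.ne _
  refine inv_eq_of_mul_eq_one_right ?_
  rw [← HahnSeries.single_zero_natCast, X, HahnSeries.single_mul_single,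
    HahnSeries.single_mul_single, mul_one, mul_one_div_cancel hn]
  rfl

theorem colSum_mul_bareG (M : Matrix (Fin n) (Fin n) (LaurentSeries ℂ)) (j : Fin n) :
    colSum (M * bareG n) j = (j : ℕ) * colSum M j := by
  simp only [colSum_apply, shear_apply, bareG, Matrix.mul_diagonal, Finset.mul_sum, map_mul,
    map_natCast]
  exact Finset.sum_congr rfl fun i _ => by ring

theorem mul_bareD (M : Matrix (Fin n) (Fin n) (LaurentSeries ℂ)) (t₀ : ℂ) (t : Fin N → ℂ) :
    M * bareD n t₀ t = (HahnSeries.single 1 (1 / (n : ℂ)) : LaurentSeries ℂ) •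
      (t₀ • M + ∑ J ∈ Finset.Icc 1 N, time t J • (M * bareH n ^ J) - M * bareG n) := by
  have hsmul : ∀ (c : ℂ) (M' : Matrix (Fin n) (Fin n) (LaurentSeries ℂ)),
      M * (c • M') = c • (M * M') := fun c M' => by
    rw [smul_eq_C_smul, smul_eq_C_smul, mul_laurent_smul]
  rw [bareD, inv_natCast_mul_X, mul_laurent_smul, mul_sub, mul_add, hsmul, mul_one,
    Finset.mul_sum, Finset.sum_congr rfl fun J _ => hsmul (time t J) (bareH n ^ J)]

theorem colSum_mul_bareD (M : Matrix (Fin n) (Fin n) (LaurentSeries ℂ)) (t₀ : ℂ) (t : Fin N → ℂ)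
    (j : Fin n) : colSum (M * bareD n t₀ t) j = ∑ J ∈ Finset.range (N + 1),
      HahnSeries.single ((n : ℤ) - J) (bareCoeff n t₀ t J) * colSum M (j + Fin.ofNat n J) -
        HahnSeries.single (n : ℤ) ((j : ℕ) / (n : ℂ)) * colSum M j := by
  have hterm : ∀ (J : ℕ) (c : ℂ), HahnSeries.single (n : ℤ) (1 / (n : ℂ)) *
      colSum (c • (M * bareH n ^ J)) j =
        HahnSeries.single ((n : ℤ) - J) (c / n) * colSum M (j + Fin.ofNat n J) := fun J c => by
    rw [smul_eq_C_smul, colSum_smul, colSum_mul_bareH_pow, HahnSeries.C_apply, expandHom_single,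
      mul_zero, qPow, ← mul_assoc, ← mul_assoc, HahnSeries.single_mul_single, add_zero,
      HahnSeries.single_mul_single, mul_one, one_div_mul_eq_div, sub_eq_add_neg]
  rw [mul_bareD, colSum_smul, expandHom_single, mul_one, map_sub, map_add, map_sum,
    Pi.sub_apply, Pi.add_apply, Finset.sum_apply, mul_sub, mul_add, Finset.mul_sum,
    colSum_mul_bareG, Finset.range_eq_Ico, Finset.sum_eq_sum_Ico_succ_bot (Nat.succ_pos N)]
  congr 1
  · congr 1
    · simpa only [pow_zero, mul_one, bareCoeff, if_pos] using hterm 0 t₀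
    · refine Finset.sum_congr (by ext; simp) fun J hJ => ?_
      rw [hterm, bareCoeff, if_neg (Nat.ne_of_gt (Finset.mem_Ico.1 hJ).1)]
  · rw [← HahnSeries.single_zero_natCast, ← mul_assoc, HahnSeries.single_mul_single, add_zero,
      one_div_mul_eq_div]

theorem coeff_bareD (t₀ : ℂ) (t : Fin N → ℂ) (i j : Fin n) (k : ℤ) :
    (bareD n t₀ t i j).coeff k = ∑ J ∈ Finset.range (N + 1),
      (if (n : ℤ) * k + j - i = n - J then bareCoeff n t₀ t J else 0) -
        if (n : ℤ) * k + j - i = n then (j : ℕ) / (n : ℂ) else 0 := by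
  have hone : ∀ j, colSum (1 : Matrix (Fin n) (Fin n) (LaurentSeries ℂ)) j = 1 := fun j => by
    rw [← mulMat_one, colSum_mulMat]
  rw [← coeff_colSum, ← one_mul (bareD n t₀ t), colSum_mul_bareD]
  simp only [hone, mul_one, HahnSeries.coeff_sub, HahnSeries.coeff_sum, HahnSeries.coeff_single]
  congr 1
  · exact Finset.sum_congr rfl fun _ _ => by congr
  · congr

theorem vanishBelow_bareD {r : ℕ} (hr : 2 ≤ r) (t₀ : ℂ) (t : Fin (r * n) → ℂ) (i j : Fin n) :
    VanishBelow (-((r - 1 : ℕ) : ℤ)) (bareD n t₀ t i j) := by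
  intro k hk
  have hj := j.2
  have hkn : (n : ℤ) * k + (r * n : ℕ) ≤ 0 := by
    have : k + r ≤ 0 := by omega
    push_cast
    nlinarith
  rw [coeff_bareD, Finset.sum_eq_zero, zero_sub, if_neg (by omega), neg_zero]
  intro J hJ
  rw [Finset.mem_range] at hJ
  rw [if_neg (by omega)]

omit [NeZero n] in
theorem natCast_mul_neg_pred {r : ℕ} (hr : 1 ≤ r) :
    (n : ℤ) * -((r - 1 : ℕ) : ℤ) = n - (r * n : ℕ) := by
  rw [Nat.cast_sub hr]
  push_cast
  ring

theorem coeff_bareD_leading {r : ℕ} (hr : 2 ≤ r) (t₀ : ℂ) (t : Fin (r * n) → ℂ) (i j : Fin n) :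
    (bareD n t₀ t i j).coeff (-((r - 1 : ℕ) : ℤ)) =
      if i ≤ j then time t (r * n - ((j : ℕ) - (i : ℕ))) / n else 0 := by
  have hi := i.2
  have hj := j.2
  have hrn : 2 * n ≤ r * n := Nat.mul_le_mul_right n hr
  rw [coeff_bareD, natCast_mul_neg_pred (by omega), if_neg (by omega), sub_zero]
  split_ifs with h <;> rw [Fin.le_def] at h
  · rw [Finset.sum_eq_single_of_mem (r * n - ((j : ℕ) - (i : ℕ)))
      (Finset.mem_range.2 (by omega)), if_pos (by omega), bareCoeff, if_neg (by omega)]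
    exact fun J _ hJ => if_neg (by omega)
  · refine Finset.sum_eq_zero fun J hJ => ?_
    rw [Finset.mem_range] at hJ
    rw [if_neg (by omega)]

end BareConnection

section Gauge

variable {n : ℕ}

theorem ddx_C_mul (c : ℂ) (f : LaurentSeries ℂ) :
    ddx (HahnSeries.C c * f) = HahnSeries.C c * ddx f := by
  rw [ddx_mul, ddx_C, zero_mul, zero_add]

theorem constCoeff_C_smul (c : ℂ) (Y : Matrix (Fin n) (Fin n) (LaurentSeries ℂ)) :
    constCoeff ((HahnSeries.C c : LaurentSeries ℂ) • Y) = c • constCoeff Y := by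
  ext i j
  simp [constCoeff]

theorem IsFormalGauge.C_smul {N : ℕ} {A : Matrix (Fin n) (Fin n) (Polynomial ℂ)} {t₀ c : ℂ}
    {t : Fin N → ℂ} {Y : Matrix (Fin n) (Fin n) (LaurentSeries ℂ)} (hY : IsFormalGauge A t₀ t Y)
    (hc : c ≠ 0) : IsFormalGauge A t₀ t ((HahnSeries.C c : LaurentSeries ℂ) • Y) where
  integral i j m hm := by simp [hY.integral i j m hm]
  det_ne_zero := by
    rw [constCoeff_C_smul, Matrix.det_smul]
    exact mul_ne_zero (pow_ne_zero _ hc) hY.det_ne_zero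
  gauge := calc
    ((HahnSeries.C c : LaurentSeries ℂ) • Y).map ddx
        = (HahnSeries.C c : LaurentSeries ℂ) • Y.map ddx := by
      ext1 i j
      exact ddx_C_mul c (Y i j)
    _ = (HahnSeries.C c : LaurentSeries ℂ) • (atInfinity A * Y) -
          (HahnSeries.C c : LaurentSeries ℂ) • (Y * bareD n t₀ t) := by
      rw [hY.gauge]
      exact smul_sub (HahnSeries.C c : LaurentSeries ℂ) (atInfinity A * Y) (Y * bareD n t₀ t)
    _ = _ := by rw [mul_laurent_smul, laurent_smul_mul]

variable {r : ℕ} {t : Fin (r * n) → ℂ} {A : Matrix (Fin n) (Fin n) (Polynomial ℂ)}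

theorem coeff_atInfinity (A : Matrix (Fin n) (Fin n) (Polynomial ℂ)) (i j : Fin n) (m : ℕ) :
    (atInfinity A i j).coeff (-(m : ℤ)) = (A i j).coeff m :=
  coeff_aeval_X _ m

theorem IsGaugeFixed.vanishBelow_atInfinity (hA : IsGaugeFixed r t A) (i j : Fin n) :
    VanishBelow (-((r - 1 : ℕ) : ℤ)) (atInfinity A i j) := by
  intro m hm
  obtain ⟨k, rfl⟩ : ∃ k : ℕ, m = -k := ⟨m.natAbs, by omega⟩
  rw [coeff_atInfinity, hA.degree _ _ _ (by omega)]

variable [NeZero n]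

theorem IsFormalGauge.leading_mul_constCoeff (hr : 2 ≤ r) (hA : IsGaugeFixed r t A) {t₀ : ℂ}
    {Y : Matrix (Fin n) (Fin n) (LaurentSeries ℂ)} (hY : IsFormalGauge A t₀ t Y) :
    A.map (fun p => p.coeff (r - 1)) * constCoeff Y =
      constCoeff Y * A.map (fun p => p.coeff (r - 1)) := by
  ext i j
  have h := congrArg (fun M => (M i j).coeff (-((r - 1 : ℕ) : ℤ))) hY.gauge
  simp only [Matrix.map_apply, Matrix.sub_apply, Matrix.mul_apply, HahnSeries.coeff_sub,
    HahnSeries.coeff_sum] at h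
  rw [coeff_ddx, hY.integral _ _ _ (by omega), mul_zero, neg_zero, eq_comm, sub_eq_zero] at h
  rw [Matrix.mul_apply, Matrix.mul_apply]
  convert h using 2 with l _ l _
  · have hcoeff := (hA.vanishBelow_atInfinity i l).coeff_mul (hY.integral l j)
    rw [add_zero, coeff_atInfinity] at hcoeff
    exact hcoeff.symm
  · have hcoeff := VanishBelow.coeff_mul (hY.integral i l) (vanishBelow_bareD hr t₀ t l j)
    rw [zero_add, coeff_bareD_leading hr, ← hA.leading] at hcoeff
    exact hcoeff.symm

theorem formalGauge_spec (hr : 2 ≤ r) (hA : IsGaugeFixed r t A) (ht : HasTimes A t) :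
    ∃ t₀ : ℂ, IsFormalGauge A t₀ t (formalGauge A t) ∧ IsNormalized (formalGauge A t) := by
  refine Classical.epsilon_spec (p := fun Y => ∃ t₀ : ℂ, IsFormalGauge A t₀ t Y ∧
    IsNormalized Y) ?_
  obtain ⟨t₀, Y, hY⟩ := ht
  have hτ : time t (r * n - 1) / n ≠ 0 := div_ne_zero hA.lidskii (NeZero.ne _)
  have hcomm := hY.leading_mul_constCoeff hr hA
  have hlow : ∀ {i j : Fin n}, j < i → constCoeff Y i j = 0 := fun hij =>
    lower_eq_zero_of_commute_toeplitz (τ := fun d => time t (r * n - d) / n) hτ hA.leading hcomm hij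
  have hdiag := diag_eq_of_commute_toeplitz (τ := fun d => time t (r * n - d) / n) hτ hA.leading
    hcomm
  have hne : constCoeff Y 0 0 ≠ 0 := fun h₀ =>
    hY.det_ne_zero <| Matrix.det_eq_zero_of_column_eq_zero 0 fun i => by
      rcases eq_or_ne i 0 with rfl | hi
      · exact h₀
      · exact hlow (Fin.pos_iff_ne_zero.2 hi)
  refine ⟨_, t₀, hY.C_smul (inv_ne_zero hne), fun i j hji => ?_⟩
  rw [constCoeff_C_smul, Matrix.smul_apply, smul_eq_mul]
  rcases hji.lt_or_eq with hlt | heq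
  · rw [hlow hlt, mul_zero, Matrix.one_apply_ne hlt.ne']
  · rw [heq, hdiag i, Matrix.one_apply_eq, inv_mul_cancel₀ hne]

end Gauge

/-! ### The spectral branch -/

section GaugeFixed

variable {n : ℕ} [NeZero n] {r : ℕ} {t : Fin (r * n) → ℂ}
  {A : Matrix (Fin n) (Fin n) (Polynomial ℂ)}

theorem IsGaugeFixed.vanishBelow_shear_atInfinity (hr : 2 ≤ r) (hA : IsGaugeFixed r t A)
    (i j : Fin n) : VanishBelow ((n : ℤ) - (r * n : ℕ)) (shear (atInfinity A) i j) := by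
  intro m hm
  obtain ⟨i', k, rfl⟩ := exists_index j m
  rcases ne_or_eq i i' with hi | rfl
  · exact coeff_shear_of_ne _ hi j k
  rw [coeff_shear]
  have hi := i.2
  rw [← natCast_mul_neg_pred (by omega)] at hm
  rcases lt_trichotomy k (-((r - 1 : ℕ) : ℤ)) with hk | rfl | hk
  · exact hA.vanishBelow_atInfinity i j k hk
  · rw [coeff_atInfinity, hA.leading, if_neg (by rw [Fin.le_def]; omega)]
  · nlinarith

theorem IsGaugeFixed.coeff_shear_atInfinity_first (hr : 2 ≤ r) (hA : IsGaugeFixed r t A)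
    (i j : Fin n) : (shear (atInfinity A) i j).coeff ((n : ℤ) - (r * n : ℕ)) =
      if i = j then time t (r * n) / n else 0 := by
  have hindex : (n : ℤ) - (r * n : ℕ) = n * -((r - 1 : ℕ) : ℤ) + j - j := by
    rw [natCast_mul_neg_pred (by omega), add_sub_cancel_right]
  rw [hindex]
  split_ifs with h
  · rw [h, coeff_shear, coeff_atInfinity, hA.leading, if_pos le_rfl, Nat.sub_self, Nat.sub_zero]
  · exact coeff_shear_of_ne _ h j _

theorem IsGaugeFixed.coeff_shear_atInfinity_second (hr : 2 ≤ r) (hA : IsGaugeFixed r t A)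
    (i j : Fin n) : (shear (atInfinity A) i j).coeff ((n : ℤ) - (r * n : ℕ) + 1) =
      if i + Fin.ofNat n 1 = j then time t (r * n - 1) / n else 0 := by
  suffices H : ∀ p q : Fin n, p + Fin.ofNat n 1 = q → ∃ k : ℤ,
      (n : ℤ) - (r * n : ℕ) + 1 = n * k + q - p ∧
        (atInfinity A p q).coeff k = time t (r * n - 1) / n by
    obtain ⟨k, hindex, hcoeff⟩ := H _ j (sub_add_cancel j (Fin.ofNat n 1))
    rw [hindex]
    split_ifs with h
    · rw [← eq_sub_iff_add_eq] at h
      rw [h, coeff_shear, hcoeff]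
    · exact coeff_shear_of_ne _ (mt eq_sub_iff_add_eq.1 h) j k
  intro p q hpq
  have hlead := natCast_mul_neg_pred (n := n) (show 1 ≤ r by omega)
  have hq : (q : ℕ) = (p + 1) % n := by rw [← hpq, Fin.val_add, Fin.val_ofNat, Nat.add_mod_mod]
  rcases (show (p : ℕ) + 1 ≤ n from p.2).lt_or_eq with h | h
  · rw [Nat.mod_eq_of_lt h] at hq
    refine ⟨-((r - 1 : ℕ) : ℤ), by rw [hlead]; omega, ?_⟩
    rw [coeff_atInfinity, hA.leading, if_pos (by rw [Fin.le_def]; omega), hq,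
      Nat.add_sub_cancel_left]
  · rw [h, Nat.mod_self] at hq
    refine ⟨-((r - 2 : ℕ) : ℤ), ?_, by rw [coeff_atInfinity, hA.subleading _ _ h hq]⟩
    rw [← hlead, hq, show (p : ℤ) = n - 1 by omega, Nat.cast_sub hr, Nat.cast_sub (by omega)]
    push_cast
    ring

theorem IsGaugeFixed.isCyclicLeading (hr : 2 ≤ r) (hA : IsGaugeFixed r t A) :
    IsCyclicLeading (shear (atInfinity A)) ((n : ℤ) - (r * n : ℕ)) (time t (r * n) / n)
      (time t (r * n - 1) / n) :=
  ⟨hA.vanishBelow_shear_atInfinity hr, hA.coeff_shear_atInfinity_first hr,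
    hA.coeff_shear_atInfinity_second hr⟩

end GaugeFixed

section Eigenvalue

variable {n : ℕ}

theorem eval_charpoly_eq_zero_iff_exists_mulVec {k : Type*} [CommRing k] [IsDomain k]
    {B : Matrix (Fin n) (Fin n) k} {y : k} :
    Polynomial.eval y B.charpoly = 0 ↔ ∃ v ≠ 0, B.mulVec v = y • v := by
  rw [Matrix.eval_charpoly, ← Matrix.exists_mulVec_eq_zero_iff]
  simp only [Matrix.sub_mulVec, sub_eq_zero, Matrix.scalar_apply, Matrix.diagonal_const_mulVec,
    eq_comm]

theorem eval_charpoly_eq_zero_of_vecMul {k : Type*} [CommRing k] [IsDomain k]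
    {B : Matrix (Fin n) (Fin n) k} {y : k} {v : Fin n → k} (hv : v ≠ 0)
    (h : Matrix.vecMul v B = y • v) : Polynomial.eval y B.charpoly = 0 := by
  rw [← Matrix.charpoly_transpose, eval_charpoly_eq_zero_iff_exists_mulVec]
  exact ⟨v, hv, by rw [Matrix.mulVec_transpose, h]⟩

theorem charpoly_map_aeval_qPow [NeZero n] (A : Matrix (Fin n) (Fin n) (Polynomial ℂ)) :
    (A.map (Polynomial.aeval (qPow n))).charpoly = (shear (atInfinity A)).charpoly := by
  obtain ⟨S, hS⟩ := exists_shear_eq_conj (n := n)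
  rw [hS, Matrix.coe_units_inv, Matrix.charpoly_units_conj]
  congr 1
  ext1 i j
  exact (expandHom_aeval n (A i j)).symm

end Eigenvalue

section Branch

variable {n : ℕ} [NeZero n] {r N : ℕ} {A : Matrix (Fin n) (Fin n) (Polynomial ℂ)}
  {l : Fin n → LaurentSeries ℂ} {y : LaurentSeries ℂ}

theorem IsSpectralBranch.eq_of_isEigenrow (hr : 2 ≤ r) {t : Fin (r * n) → ℂ}
    (hA : IsGaugeFixed r t A) (hl : IsEigenrow (shear (atInfinity A)) l y)
    {y' : LaurentSeries ℂ} (hy' : IsSpectralBranch A t y') : y' = y := by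
  have hrn : 2 * n ≤ r * n := Nat.mul_le_mul_right n hr
  have hn := NeZero.pos n
  obtain ⟨hroot, hcoeff⟩ := hy'
  rw [charpoly_map_aeval_qPow] at hroot
  obtain ⟨u, hu, hBu⟩ := eval_charpoly_eq_zero_iff_exists_mulVec.1 hroot
  refine (hA.isCyclicLeading hr).eigenvalue_eq (NeZero.ne _)
    (div_ne_zero hA.lidskii (NeZero.ne _)) hl (fun m hm => ?_) (hcoeff _ (by omega)) ?_ hu hBu
  · obtain ⟨J, rfl⟩ : ∃ J : ℕ, m = n - J := ⟨(n - m).toNat, by omega⟩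
    rw [hcoeff J (by omega), time, dif_neg (by omega), zero_div]
  · rw [← hcoeff _ (by omega), Nat.cast_sub (by omega), Nat.cast_one, sub_sub_eq_add_sub,
      add_sub_right_comm]

theorem unshear_mul_of_vecMul_shear {M : Matrix (Fin n) (Fin n) (LaurentSeries ℂ)}
    (h : Matrix.vecMul l (shear M) = y • l) : unshear l * M = mulMat y * unshear l := by
  apply colSum_injective
  rw [colSum_mul, colSum_mulMat_mul, colSum_unshear, h]

theorem vanishBelow_shear_ddx {Y : Matrix (Fin n) (Fin n) (LaurentSeries ℂ)}
    (hY : ∀ i j, VanishBelow 0 (Y i j)) (i j : Fin n) :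
    VanishBelow (n : ℤ) (shear (Y.map ddx) i j) := by
  intro m hm
  obtain ⟨i', k, rfl⟩ := exists_index j m
  rcases ne_or_eq i i' with hi | rfl
  · exact coeff_shear_of_ne _ hi j k
  rw [coeff_shear, Matrix.map_apply, coeff_ddx]
  have hi := i.2
  rcases eq_or_ne k 1 with rfl | hk
  · simp
  · have : k < 2 := by nlinarith
    rw [hY _ _ _ (by omega), mul_zero, neg_zero]

variable {t₀ : ℂ} {t : Fin N → ℂ} {Y : Matrix (Fin n) (Fin n) (LaurentSeries ℂ)}

/-- In the gauge `W = unshear l * Y` the bare connection becomes multiplication by `y`, up to the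
terms coming from `∂ₓY` and `G`, which are `O(q ^ (-n))`. -/
theorem IsEigenrow.vanishBelow_colSum_sub (hl : IsEigenrow (shear (atInfinity A)) l y)
    (hY : IsFormalGauge A t₀ t Y) (hW : IsUnipotent (unshear l * Y)) (j : Fin n) :
    VanishBelow (n : ℤ) (y * colSum (unshear l * Y) j - ∑ J ∈ Finset.range (N + 1),
      HahnSeries.single ((n : ℤ) - J) (bareCoeff n t₀ t J) *
        colSum (unshear l * Y) (j + Fin.ofNat n J)) := by
  have hgauge : mulMat y * (unshear l * Y) - unshear l * Y * bareD n t₀ t =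
      unshear l * Y.map ddx := by
    rw [hY.gauge, mul_sub, ← mul_assoc, ← mul_assoc, unshear_mul_of_vecMul_shear hl.eigen,
      ← mul_assoc]
  have hddx : VanishBelow (n : ℤ) (colSum (unshear l * Y.map ddx) j) := by
    rw [colSum_apply]
    refine VanishBelow.sum fun i _ => ?_
    rw [map_mul]
    simpa only [zero_add] using vanishBelow_matrix_mul
      (IsUnipotent.unshear hl.integral hl.coeff_zero).integral (vanishBelow_shear_ddx hY.integral)
      i j
  have hG := (hW.vanishBelow_colSum j).single_mul (n : ℤ) ((j : ℕ) / (n : ℂ))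
  rw [add_zero] at hG
  have hsub := hddx.sub hG
  rwa [← hgauge, map_sub, Pi.sub_apply, colSum_mulMat_mul, colSum_mul_bareD, Pi.smul_apply,
    smul_eq_mul, sub_sub, sub_add_cancel] at hsub

theorem IsEigenrow.isSpectralBranch (hl : IsEigenrow (shear (atInfinity A)) l y)
    (hY : IsFormalGauge A t₀ t Y) (hN : IsNormalized Y) : IsSpectralBranch A t y := by
  have hW := (IsUnipotent.unshear hl.integral hl.coeff_zero).mul
    (IsUnipotent.of_isNormalized hY.integral hN)
  refine ⟨?_, fun J hJ => ?_⟩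
  · rw [charpoly_map_aeval_qPow]
    refine eval_charpoly_eq_zero_of_vecMul (fun h => ?_) hl.eigen
    simpa [h] using hl.coeff_zero 0
  have hcoeff := vanishBelow_eigenvalue_sub _ (NeZero.ne _) hW.vanishBelow_colSum
    hW.coeff_zero_colSum (hl.vanishBelow_colSum_sub hY hW) (n - J) (by omega)
  rw [HahnSeries.coeff_sub, sub_eq_zero, HahnSeries.coeff_sum] at hcoeff
  have hsingle : ∀ J' ≠ J, (HahnSeries.single ((n : ℤ) - J') (bareCoeff n t₀ t J')).coeff
      ((n : ℤ) - J) = 0 := fun J' hJ' => HahnSeries.coeff_single_of_ne (by omega)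
  rw [hcoeff, Finset.sum_eq_single J (fun J' _ => hsingle J'), HahnSeries.coeff_single_same,
    bareCoeff, if_neg (by omega)]
  intro hmem
  rw [Finset.mem_range] at hmem
  rw [HahnSeries.coeff_single_same, bareCoeff, if_neg (by omega), time, dif_neg (by omega),
    zero_div]

theorem IsEigenrow.spectralBranch_eq (hr : 2 ≤ r) {t : Fin (r * n) → ℂ} (hA : IsGaugeFixed r t A)
    (ht : HasTimes A t) (hl : IsEigenrow (shear (atInfinity A)) l y) :
    spectralBranch A t = y := by
  obtain ⟨t₀, hY, hN⟩ := formalGauge_spec hr hA ht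
  exact IsSpectralBranch.eq_of_isEigenrow hr hA hl (Classical.epsilon_spec
    (p := fun y => IsSpectralBranch A t y) ⟨y, hl.isSpectralBranch hY hN⟩)

theorem IsEigenrow.vanishBelow_colSum_sub_colSum (hl : IsEigenrow (shear (atInfinity A)) l y)
    (hY : IsFormalGauge A t₀ t Y) (hN : IsNormalized Y) (hdvd : n ∣ N)
    (ht : time t (N - 1) ≠ 0) (i j : Fin n) :
    VanishBelow (N - 1) (colSum (unshear l * Y) i - colSum (unshear l * Y) j) := by
  have hW := (IsUnipotent.unshear hl.integral hl.coeff_zero).mul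
    (IsUnipotent.of_isNormalized hY.integral hN)
  have hpos : 1 ≤ N - 1 := by
    by_contra h
    exact ht (dif_neg fun h' => h h'.1)
  obtain ⟨M, rfl⟩ : ∃ M, N = M + 1 := ⟨N - 1, by omega⟩
  rw [Nat.add_sub_cancel] at ht hpos
  have hc : bareCoeff n t₀ t M ≠ 0 := by
    rw [bareCoeff, if_neg (by omega)]
    exact div_ne_zero ht (NeZero.ne _)
  rw [Nat.cast_succ, add_sub_cancel_right]
  exact vanishBelow_sub_of_approx_eigenrow (NeZero.ne _) hdvd hc hW.vanishBelow_colSum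
    hW.coeff_zero_colSum (hl.vanishBelow_colSum_sub hY hW) i j

end Branch

section Deformation

variable {n : ℕ} [NeZero n]

theorem vanishBelow_colSum_bareH_pow_commutator {W : Matrix (Fin n) (Fin n) (LaurentSeries ℂ)}
    {N J : ℕ} (hN : n ∣ N) (hJ : J ≤ N)
    (hW : ∀ i j, VanishBelow (N - 1) (colSum W i - colSum W j)) (j : Fin n) :
    VanishBelow 0 (colSum (bareH n ^ J * W - W * bareH n ^ J) j) := by
  rw [map_sub, Pi.sub_apply, colSum_mul_bareH_pow, bareH_pow_eq_mulMat, colSum_mulMat_mul,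
    Pi.smul_apply, smul_eq_mul, ← mul_sub]
  rcases hJ.lt_or_eq with h | rfl
  · exact ((hW j (j + Fin.ofNat n J)).single_mul (-(J : ℤ)) 1).mono (by omega)
  · rw [ofNat_eq_zero hN, add_zero, sub_self, mul_zero]
    exact VanishBelow.zero

theorem vanishBelow_conj_sub_conj {Z Y P : Matrix (Fin n) (Fin n) (LaurentSeries ℂ)}
    (hZ : IsUnipotent Z) (hY : IsUnipotent Y)
    (hP : ∀ j, VanishBelow 0 (colSum (P * (Z * Y) - Z * Y * P) j)) (i j : Fin n) :
    VanishBelow 0 ((Z⁻¹ * P * Z - Y * P * Y⁻¹) i j) := by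
  have hZZ : Z⁻¹ * Z = 1 := Matrix.nonsing_inv_mul _ hZ.isUnit_det
  have hYY : Y * Y⁻¹ = 1 := Matrix.mul_nonsing_inv _ hY.isUnit_det
  have hleft : Z⁻¹ * (P * (Z * Y)) * Y⁻¹ = Z⁻¹ * P * Z * (Y * Y⁻¹) := by simp only [mul_assoc]
  have hright : Z⁻¹ * (Z * Y * P) * Y⁻¹ = Z⁻¹ * Z * (Y * P * Y⁻¹) := by simp only [mul_assoc]
  have hconj : Z⁻¹ * P * Z - Y * P * Y⁻¹ = Z⁻¹ * (P * (Z * Y) - Z * Y * P) * Y⁻¹ := by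
    rw [mul_sub, sub_mul, hleft, hright, hZZ, hYY, mul_one, one_mul]
  apply vanishBelow_of_shear
  rw [hconj, map_mul, map_mul]
  simpa only [add_zero] using vanishBelow_matrix_mul (vanishBelow_matrix_mul hZ.integral_inv
    (vanishBelow_shear hP)) hY.integral_inv i j

/-- The conjugate `Z⁻¹ 𝓗 ^ J Z` of `𝓗 ^ J` by the matrix `Z = unshear l` of a row `l`. -/
def dressed (l : Fin n → LaurentSeries ℂ) (J : ℕ) : Matrix (Fin n) (Fin n) (LaurentSeries ℂ) :=
  (unshear l)⁻¹ * bareH n ^ J * unshear l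

/-- The spectral matrix `unshear l` may replace `Y⁻¹` in the deformation matrix `𝓣_J`, up to a
term constant in `x`. -/
theorem IsEigenrow.derivative_deform {r : ℕ} (hr : 2 ≤ r) {t : Fin (r * n) → ℂ}
    {A : Matrix (Fin n) (Fin n) (Polynomial ℂ)} (hA : IsGaugeFixed r t A) (ht : HasTimes A t)
    {l : Fin n → LaurentSeries ℂ} {y : LaurentSeries ℂ}
    (hl : IsEigenrow (shear (atInfinity A)) l y) {J : ℕ} (hJ : J ≤ r * n) :
    atInfinity ((deform A t J).map Polynomial.derivative) =
      (HahnSeries.C (1 / (J : ℂ)) : LaurentSeries ℂ) •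
        ((dressed l J).map nonnegPart).map ddx := by
  obtain ⟨t₀, hY, hN⟩ := formalGauge_spec hr hA ht
  have hdiff := vanishBelow_conj_sub_conj (IsUnipotent.unshear hl.integral hl.coeff_zero)
    (IsUnipotent.of_isNormalized hY.integral hN) (vanishBelow_colSum_bareH_pow_commutator
      (Dvd.intro_left r rfl) hJ (hl.vanishBelow_colSum_sub_colSum hY hN (Dvd.intro_left r rfl)
        hA.lidskii))
  ext1 i j
  rw [Matrix.smul_apply, Matrix.map_apply, Matrix.map_apply, dressed,
    ddx_nonnegPart_eq_of_vanishBelow (hdiff i j), smul_eq_mul, atInfinity, Matrix.map_apply,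
    Matrix.map_apply, deform, Matrix.smul_apply, Polynomial.smul_eq_C_mul,
    Polynomial.derivative_C_mul, map_mul, Polynomial.aeval_C, algebraMap_eq_C, Matrix.map_apply,
    nonnegPart, ddx_aeval_X]

end Deformation

/-! ### Holomorphic coefficients -/

theorem coeff_mul_of_support_subset {Γ R : Type*} [AddCommMonoid Γ] [PartialOrder Γ]
    [IsOrderedCancelAddMonoid Γ] [NonUnitalNonAssocSemiring R] {f g : HahnSeries Γ R} {s t : Set Γ}
    (hs : s.IsPWO) (ht : t.IsPWO) (hfs : f.support ⊆ s) (hgt : g.support ⊆ t) (m : Γ) :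
    (f * g).coeff m = ∑ p ∈ Finset.antidiagonal hs ht m, f.coeff p.1 * g.coeff p.2 := by
  rw [HahnSeries.coeff_mul_left' hs hfs]
  refine Finset.sum_subset (fun p hp => ?_) fun p hp hp' => ?_
  · rw [Finset.mem_antidiagonal] at hp ⊢
    exact ⟨hp.1, hgt hp.2.1, hp.2.2⟩
  · rw [Finset.mem_antidiagonal] at hp hp'
    have hg : g.coeff p.2 = 0 := by
      by_contra h
      exact hp' ⟨hp.1, h, hp.2.2⟩
    rw [hg, mul_zero]

section LaurentMaps

variable {k k' : Type*} [CommRing k] [CommRing k']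

theorem VanishBelow.map {f : LaurentSeries k} {a : ℤ} (hf : VanishBelow a f) (D : k →+ k') :
    VanishBelow a (f.map D) := fun m hm => by
  rw [HahnSeries.map_coeff, hf m hm, map_zero]

theorem map_laurent_mul (ev : k →+* k') (f g : LaurentSeries k) :
    (f * g).map ev = f.map ev * g.map ev :=
  HahnSeries.map_mul (ev : k →ₙ+* k')

theorem map_laurent_sum {ι : Type*} (D : k →+ k') (s : Finset ι) (f : ι → LaurentSeries k) :
    (∑ i ∈ s, f i).map D = ∑ i ∈ s, (f i).map D := by
  ext m
  simp only [HahnSeries.map_coeff, HahnSeries.coeff_sum, map_sum]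

theorem map_laurent_leibniz {ev : k →+* k'} {D : k →+ k'}
    (hD : ∀ a b, D (a * b) = D a * ev b + ev a * D b) (f g : LaurentSeries k) :
    (f * g).map D = f.map D * g.map ev + f.map ev * g.map D := by
  have hsupp : ∀ (φ : k →+ k') (f : LaurentSeries k), (f.map φ).support ⊆ f.support :=
    fun φ f m hm h => hm (by rw [HahnSeries.map_coeff, h, map_zero])
  have hev : ∀ f : LaurentSeries k, (f.map ev).support ⊆ f.support := hsupp (ev : k →+ k')
  ext m
  rw [HahnSeries.map_coeff, HahnSeries.coeff_mul, map_sum, HahnSeries.coeff_add,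
    coeff_mul_of_support_subset f.isPWO_support g.isPWO_support (hsupp D f) (hev g),
    coeff_mul_of_support_subset f.isPWO_support g.isPWO_support (hev f) (hsupp D g),
    ← Finset.sum_add_distrib]
  exact Finset.sum_congr rfl fun _ _ => hD _ _

end LaurentMaps

section HoloRing

variable {E : Type*} [NormedAddCommGroup E] [NormedSpace ℂ E] {U : Set E}

/-- The ring of holomorphic functions on `U`, encoded as the functions on the subtype `U` whose
extension by zero is complex differentiable on `U`. -/
def holoRing (U : Set E) : Subring (U → ℂ) where
  carrier := {f | DifferentiableOn ℂ (Function.extend Subtype.val f 0) U}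
  mul_mem' {f g} hf hg := by
    simpa only [Set.mem_ofPred_eq, ← Function.extend_mul, mul_zero] using hf.mul hg
  one_mem' := (differentiableOn_const (1 : ℂ)).congr fun u hu =>
    Subtype.val_injective.extend_apply (1 : U → ℂ) 0 ⟨u, hu⟩
  add_mem' {f g} hf hg := by
    simpa only [Set.mem_ofPred_eq, ← Function.extend_add, add_zero] using hf.add hg
  zero_mem' := by
    simpa only [Set.mem_ofPred_eq, Function.extend_zero] using differentiableOn_zero
  neg_mem' {f} hf := by
    simpa only [Set.mem_ofPred_eq, ← Function.extend_neg, neg_zero] using hf.neg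

/-- The extension by zero of a holomorphic function on `U`. -/
def extendZero (f : holoRing U) : E → ℂ := Function.extend Subtype.val (f : U → ℂ) 0

/-- The evaluation of holomorphic functions at a point of `U`. -/
def evalAt (u : U) : holoRing U →+* ℂ := (Pi.evalRingHom _ u).comp (holoRing U).subtype

theorem extendZero_apply (f : holoRing U) (u : U) : extendZero f u = evalAt u f :=
  Subtype.val_injective.extend_apply _ _ u

theorem differentiableOn_extendZero (f : holoRing U) : DifferentiableOn ℂ (extendZero f) U := f.2

/-- The restriction to `U` of a function which is complex differentiable on `U`. -/
def toHolo (g : E → ℂ) (hg : DifferentiableOn ℂ g U) : holoRing U :=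
  ⟨fun u => g u, hg.congr fun u hu =>
    Subtype.val_injective.extend_apply (fun u : U => g u) 0 ⟨u, hu⟩⟩

theorem isUnit_toHolo {g : E → ℂ} (hg : DifferentiableOn ℂ g U) (h : ∀ u ∈ U, g u ≠ 0) :
    IsUnit (toHolo g hg) := by
  refine .of_mul_eq_one (toHolo (fun t => (g t)⁻¹) (hg.inv h)) ?_
  ext u
  exact mul_inv_cancel₀ (h u u.2)

theorem isUnit_natCast_holoRing {n : ℕ} (hn : n ≠ 0) : IsUnit (n : holoRing U) :=
  isUnit_toHolo (differentiableOn_const (n : ℂ)) fun _ _ => Nat.cast_ne_zero.2 hn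

variable (hU : IsOpen U)
include hU

theorem differentiableAt_extendZero (f : holoRing U) (u : U) :
    DifferentiableAt ℂ (extendZero f) u :=
  (differentiableOn_extendZero f).differentiableAt (hU.mem_nhds u.2)

/-- The derivative of holomorphic functions at the point `u`, in the direction `v`. -/
def derivAt (u : U) (v : E) : holoRing U →+ ℂ where
  toFun f := fderiv ℂ (extendZero f) u v
  map_zero' := by
    rw [show extendZero (0 : holoRing U) = 0 from Function.extend_zero _, fderiv_zero]
    rfl
  map_add' f g := by
    have hadd : extendZero (f + g) = extendZero f + extendZero g := by
      simp only [extendZero, ← Function.extend_add, add_zero, Subring.coe_add]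
    rw [hadd, fderiv_add (differentiableAt_extendZero hU f u) (differentiableAt_extendZero hU g u)]
    rfl

theorem derivAt_apply (u : U) (v : E) (f : holoRing U) :
    derivAt hU u v f = fderiv ℂ (extendZero f) u v := rfl

theorem derivAt_mul (u : U) (v : E) (f g : holoRing U) :
    derivAt hU u v (f * g) = derivAt hU u v f * evalAt u g + evalAt u f * derivAt hU u v g := by
  have hmul : extendZero (f * g) = extendZero f * extendZero g := by
    simp only [extendZero, ← Function.extend_mul, mul_zero, Subring.coe_mul]
  rw [derivAt_apply, hmul, fderiv_mul (differentiableAt_extendZero hU f u)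
    (differentiableAt_extendZero hU g u), extendZero_apply, extendZero_apply]
  simp only [add_apply, smul_apply, smul_eq_mul, derivAt_apply]
  ring

theorem derivAt_toHolo (u : U) (v : E) {g : E → ℂ} (hg : DifferentiableOn ℂ g U) :
    derivAt hU u v (toHolo g hg) = fderiv ℂ g u v := by
  have heq : extendZero (toHolo g hg) =ᶠ[nhds (u : E)] g := by
    filter_upwards [hU.mem_nhds u.2] with t ht
    exact extendZero_apply (toHolo g hg) ⟨t, ht⟩
  rw [derivAt_apply, heq.fderiv_eq]

end HoloRing

/-! ### Variation of the spectral branch -/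

section Variation

variable {n : ℕ} [NeZero n]

theorem eq_conj_mulMat {l : Fin n → LaurentSeries ℂ} {y : LaurentSeries ℂ}
    {M : Matrix (Fin n) (Fin n) (LaurentSeries ℂ)} (hl : IsUnit (unshear l).det)
    (h : Matrix.vecMul l (shear M) = y • l) : M = (unshear l)⁻¹ * mulMat y * unshear l := by
  rw [mul_assoc, ← unshear_mul_of_vecMul_shear h, ← mul_assoc, Matrix.nonsing_inv_mul _ hl, one_mul]

theorem dressed_mul_comm {l : Fin n → LaurentSeries ℂ} {y : LaurentSeries ℂ}
    {M : Matrix (Fin n) (Fin n) (LaurentSeries ℂ)} (hl : IsUnit (unshear l).det)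
    (h : Matrix.vecMul l (shear M) = y • l) (K : ℕ) : dressed l K * M = M * dressed l K := by
  have hZ := Matrix.nonsing_inv_mul _ hl
  rw [eq_conj_mulMat hl h, dressed, conj_mul_conj hZ, conj_mul_conj hZ, bareH_pow_eq_mulMat,
    ← mulMat_mul, ← mulMat_mul, mul_comm]

/-- First order perturbation of the eigenvalue `y` of `M` with row eigenvector `l`, where `M'`,
`l'` and `y'` are the first variations of `M`, `l` and `y`. -/
theorem trace_dressed_mul_variation {l l' : Fin n → LaurentSeries ℂ} {y y' : LaurentSeries ℂ}
    {M M' : Matrix (Fin n) (Fin n) (LaurentSeries ℂ)} (hl : IsUnit (unshear l).det)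
    (h : Matrix.vecMul l (shear M) = y • l)
    (h' : Matrix.vecMul l' (shear M) + Matrix.vecMul l (shear M') = y' • l + y • l') (K : ℕ) :
    (dressed l K * M').trace = (mulMat (n := n) (qPow K * y')).trace := by
  set Z := unshear l with hZ
  set Z' := unshear l' with hZ'
  have hZV : Z * Z⁻¹ = 1 := Matrix.mul_nonsing_inv _ hl
  have hvar : Z * M' = mulMat y' * Z + mulMat y * Z' - Z' * M := by
    refine eq_sub_of_add_eq' (colSum_injective ?_)
    rw [map_add, map_add, colSum_mul, colSum_mul, colSum_mulMat_mul, colSum_mulMat_mul, hZ, hZ',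
      colSum_unshear, colSum_unshear, h']
  have hMV : M * Z⁻¹ = Z⁻¹ * mulMat y := by
    rw [eq_conj_mulMat hl h, ← hZ, mul_assoc, hZV, mul_one]
  have hconj : Z * M' * Z⁻¹ =
      mulMat y' + (mulMat y * (Z' * Z⁻¹) - Z' * Z⁻¹ * mulMat y) := by
    rw [hvar, sub_mul, add_mul, mul_assoc, hZV, mul_one, mul_assoc, mul_assoc Z', hMV,
      ← mul_assoc Z', add_sub_assoc]
  have hcomm : mulMat (n := n) (qPow K) * mulMat y = mulMat y * mulMat (qPow K) := by
    rw [← mulMat_mul, ← mulMat_mul, mul_comm]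
  have hcycle : (dressed l K * M').trace = (mulMat (qPow K) * (Z * M' * Z⁻¹)).trace := by
    rw [dressed, ← hZ, bareH_pow_eq_mulMat, mul_assoc, mul_assoc, Matrix.trace_mul_comm, mul_assoc]
  rw [hcycle, hconj, mul_add, Matrix.trace_add, mul_sub, Matrix.trace_sub,
    trace_mul_mul_comm_of_mul_comm hcomm, sub_self, add_zero, ← mulMat_mul]

theorem trace_mulMat_qPow_mul_coeff_one (y : LaurentSeries ℂ) (K : ℕ) :
    (mulMat (n := n) (qPow K * y)).trace.coeff 1 = n * y.coeff (n + K) := by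
  rw [trace_mulMat_coeff, qPow, HahnSeries.coeff_single_mul, one_mul, mul_one, sub_neg_eq_add]

theorem residue_trace_dressed_symm {l : Fin n → LaurentSeries ℂ} (hl : IsUnit (unshear l).det)
    {J K : ℕ} (hJ : 1 ≤ J) (hK : 1 ≤ K) :
    (dressed l K * ((dressed l J).map nonnegPart).map ddx).trace.coeff 1 =
      (dressed l J * ((dressed l K).map nonnegPart).map ddx).trace.coeff 1 := by
  rw [← sub_eq_zero, residue_trace_mul_ddx_nonnegPart_sub, dressed, dressed,
    trace_conj_mul_ddx_conj (Matrix.nonsing_inv_mul _ hl) (by rw [← pow_add, ← pow_add, add_comm]),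
    residue_trace_bareH_pow_mul_ddx hJ hK]

end Variation

section Coefficients

variable {n : ℕ}

theorem atInfinity_mul (A B : Matrix (Fin n) (Fin n) (Polynomial ℂ)) :
    atInfinity (A * B) = atInfinity A * atInfinity B :=
  Matrix.map_mul (f := (Polynomial.aeval X : Polynomial ℂ →ₐ[ℂ] LaurentSeries ℂ))

theorem atInfinity_add (A B : Matrix (Fin n) (Fin n) (Polynomial ℂ)) :
    atInfinity (A + B) = atInfinity A + atInfinity B :=
  Matrix.map_add _ (map_add _) A B

theorem atInfinity_sub (A B : Matrix (Fin n) (Fin n) (Polynomial ℂ)) :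
    atInfinity (A - B) = atInfinity A - atInfinity B :=
  Matrix.map_sub _ (map_sub _) A B

/-- The sheared matrix `q ^ (i - j) ∑ₘ c m i j x ^ m`, `x = q ^ n`, of the matrix polynomial of
degree less than `r` with coefficients `c m`. Unlike `shear`, it makes sense over any ring of
coefficients. -/
def shearSeries {k : Type*} [AddCommMonoid k] (r : ℕ) (c : ℕ → Matrix (Fin n) (Fin n) k) :
    Matrix (Fin n) (Fin n) (LaurentSeries k) :=
  Matrix.of fun i j => ∑ m ∈ Finset.range r, HahnSeries.single ((j : ℤ) - i - n * m) (c m i j)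

theorem shearSeries_map {k k' : Type*} [CommRing k] [CommRing k'] (D : k →+ k') (r : ℕ)
    (c : ℕ → Matrix (Fin n) (Fin n) k) :
    (shearSeries r c).map (fun f => f.map D) = shearSeries r fun m => (c m).map D := by
  ext1 i j
  rw [Matrix.map_apply, shearSeries, Matrix.of_apply, map_laurent_sum, shearSeries, Matrix.of_apply]
  exact Finset.sum_congr rfl fun m _ => HahnSeries.map_single (D : ZeroHom k k')

theorem shear_atInfinity_eq_shearSeries [NeZero n] {r : ℕ}
    {A : Matrix (Fin n) (Fin n) (Polynomial ℂ)} (hA : ∀ i j m, r ≤ m → (A i j).coeff m = 0) :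
    shear (atInfinity A) = shearSeries r fun m => A.map fun p => p.coeff m := by
  ext1 i j
  have hdeg : (A i j).natDegree ≤ r := Polynomial.natDegree_le_iff_coeff_eq_zero.2
    fun m hm => hA i j m (by omega)
  rw [shear_apply, atInfinity, Matrix.map_apply,
    (A i j).as_sum_range' (r + 1) (by omega), Finset.sum_range_succ, hA i j r le_rfl]
  simp only [map_sum, map_zero, add_zero, aeval_X_monomial, expandHom_single, Finset.mul_sum,
    HahnSeries.single_mul_single, one_mul, shearSeries, Matrix.of_apply, Matrix.map_apply, mul_neg,
    ← sub_eq_add_neg]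

end Coefficients

section Parameters

variable {n : ℕ}

theorem IsEigenrow.map {k k' : Type*} [CommRing k] [CommRing k']
    {B : Matrix (Fin n) (Fin n) (LaurentSeries k)} {l : Fin n → LaurentSeries k}
    {y : LaurentSeries k} (hl : IsEigenrow B l y) (ev : k →+* k') :
    IsEigenrow (B.map fun f => f.map ev) (fun j => (l j).map ev) (y.map ev) := by
  refine ⟨?_, fun j => (hl.integral j).map (ev : k →+ k'), fun j => ?_⟩
  · ext1 j
    have h := congrArg (fun f => f.map (ev : k →+ k')) (congrFun hl.eigen j)
    have hmul : ∀ f g : LaurentSeries k,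
      (f * g).map (ev : k →+ k') = f.map ev * g.map ev := map_laurent_mul ev
    simp only [Matrix.vecMul, dotProduct, Pi.smul_apply, smul_eq_mul, map_laurent_sum, hmul] at h
    exact h
  · rw [HahnSeries.map_coeff, hl.coeff_zero, map_one]

theorem IsEigenrow.vecMul_add_vecMul {k k' : Type*} [CommRing k] [CommRing k']
    {B : Matrix (Fin n) (Fin n) (LaurentSeries k)} {l : Fin n → LaurentSeries k}
    {y : LaurentSeries k} (hl : IsEigenrow B l y) {ev : k →+* k'} {D : k →+ k'}
    (hD : ∀ a b, D (a * b) = D a * ev b + ev a * D b) :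
    Matrix.vecMul (fun j => (l j).map D) (B.map fun f => f.map ev) +
        Matrix.vecMul (fun j => (l j).map ev) (B.map fun f => f.map D) =
      y.map D • (fun j => (l j).map ev) + y.map ev • fun j => (l j).map D := by
  ext1 j
  have h := congrArg (fun f => f.map D) (congrFun hl.eigen j)
  simpa only [Matrix.vecMul, dotProduct, Pi.smul_apply, Pi.add_apply, smul_eq_mul,
    Matrix.map_apply, map_laurent_sum, map_laurent_leibniz hD, Finset.sum_add_distrib] using h

variable {E : Type*} [NormedAddCommGroup E] [NormedSpace ℂ E] {U : Set E}

theorem isCyclicLeading_of_evalAt [NeZero n]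
    {B : Matrix (Fin n) (Fin n) (LaurentSeries (holoRing U))} {N : ℤ} {τ τ' : holoRing U}
    (hB : ∀ u : U, IsCyclicLeading (B.map fun f => f.map (evalAt u)) N (evalAt u τ')
      (evalAt u τ)) : IsCyclicLeading B N τ' τ := by
  refine ⟨fun i j m hm => ?_, fun i j => ?_, fun i j => ?_⟩ <;> ext u
  · exact (hB u).vanishBelow i j m hm
  · exact ((hB u).coeff_first i j).trans (by split_ifs <;> rfl)
  · exact ((hB u).coeff_second i j).trans (by split_ifs <;> rfl)

end Parameters

/-! ### Isomonodromic deformations -/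

theorem differentiable_time {N : ℕ} (J : ℕ) : Differentiable ℂ fun t : Fin N → ℂ => time t J := by
  unfold time
  split_ifs with h <;> fun_prop

theorem residue_qPow_mul (n K : ℕ) (y : LaurentSeries ℂ) :
    residue n (qPow K * y) = n * y.coeff (n + K) := by
  rw [residue, ← HahnSeries.single_zero_natCast, qPow, qPow, HahnSeries.single_mul_single, mul_one,
    mul_comm, ← mul_assoc, HahnSeries.single_mul_single, HahnSeries.coeff_single_mul, mul_one]
  congr 2
  ring

namespace IsDeformation

variable {n r : ℕ} {U : Set (Fin (r * n) → ℂ)}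
  {A : (Fin (r * n) → ℂ) → Matrix (Fin n) (Fin n) (Polynomial ℂ)}

/-- The sheared matrix of a deformation, with its coefficients regarded as holomorphic functions of
the times. -/
def holoShear (hA : IsDeformation n r U A) : Matrix (Fin n) (Fin n) (LaurentSeries (holoRing U)) :=
  shearSeries r fun m => Matrix.of fun i j =>
    toHolo (fun t => (A t i j).coeff m) (hA.holomorphic i j m)

variable [NeZero n]

theorem holoShear_map_evalAt (hA : IsDeformation n r U A) (u : U) :
    (hA.holoShear.map fun f => f.map (evalAt u)) = shear (atInfinity (A u)) := by
  rw [shear_atInfinity_eq_shearSeries (hA.gaugeFixed u u.2).degree]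
  exact shearSeries_map (evalAt u : holoRing U →+ ℂ) r _

theorem exists_isEigenrow_holoShear (hr : 2 ≤ r) (hA : IsDeformation n r U A) :
    ∃ l y, IsEigenrow hA.holoShear l y := by
  have hdiff (J : ℕ) : DifferentiableOn ℂ (fun t : Fin (r * n) → ℂ => time t J / (n : ℂ)) U := by
    simp only [div_eq_mul_inv]
    exact ((differentiable_time J).mul_const _).differentiableOn
  refine IsCyclicLeading.exists_isEigenrow (isUnit_natCast_holoRing (NeZero.ne n))
    (isUnit_toHolo (hdiff (r * n - 1)) fun u hu => div_ne_zero (hA.gaugeFixed u hu).lidskii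
      (NeZero.ne _)) (τ' := toHolo _ (hdiff (r * n))) (N := (n : ℤ) - (r * n : ℕ))
    (isCyclicLeading_of_evalAt fun u => ?_)
  rw [hA.holoShear_map_evalAt]
  exact (hA.gaugeFixed u u.2).isCyclicLeading hr

theorem isEigenrow_evalAt {hA : IsDeformation n r U A} {l : Fin n → LaurentSeries (holoRing U)}
    {y : LaurentSeries (holoRing U)} (hl : IsEigenrow hA.holoShear l y) (u : U) :
    IsEigenrow (shear (atInfinity (A u))) (fun j => (l j).map (evalAt u)) (y.map (evalAt u)) := by
  rw [← hA.holoShear_map_evalAt]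
  exact hl.map (evalAt u)

theorem holoShear_map_derivAt (hU : IsOpen U) (hA : IsDeformation n r U A) (u : U)
    (j : Fin (r * n)) :
    (hA.holoShear.map fun f => f.map (derivAt hU u (Pi.single j 1))) =
      shear (atInfinity ((deform (A u) (u : Fin (r * n) → ℂ) (j + 1)).map Polynomial.derivative +
        (deform (A u) (u : Fin (r * n) → ℂ) (j + 1) * A u -
          A u * deform (A u) (u : Fin (r * n) → ℂ) (j + 1)))) := by
  rw [shear_atInfinity_eq_shearSeries (r := r), holoShear, shearSeries_map]
  · congr 1
    ext m a b
    exact (derivAt_toHolo hU u _ (hA.holomorphic a b m)).trans (hA.zeroCurvature u u.2 j a b m)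
  · intro a b m hm
    have hzero : (fun s => (A s a b).coeff m) =ᶠ[nhds (u : Fin (r * n) → ℂ)] fun _ => 0 := by
      filter_upwards [hU.mem_nhds u.2] with s hs
      exact (hA.gaugeFixed s hs).degree a b m hm
    rw [← hA.zeroCurvature u u.2, hzero.fderiv_eq, fderiv_fun_const]
    rfl

variable {hA : IsDeformation n r U A} {l : Fin n → LaurentSeries (holoRing U)}
  {y : LaurentSeries (holoRing U)}

theorem natCast_mul_derivAt_coeff (hr : 2 ≤ r) (hU : IsOpen U) (hl : IsEigenrow hA.holoShear l y)
    (u : U) (j : Fin (r * n)) (K : ℕ) :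
    n * derivAt hU u (Pi.single j 1) (y.coeff (n + K)) = 1 / ((j + 1 : ℕ) : ℂ) *
      (dressed (fun i => (l i).map (evalAt u)) K *
        ((dressed (fun i => (l i).map (evalAt u)) (j + 1)).map nonnegPart).map
          ddx).trace.coeff 1 := by
  have hlu := isEigenrow_evalAt hl u
  have hdet := (IsUnipotent.unshear hlu.integral hlu.coeff_zero).isUnit_det
  have hvar := hl.vecMul_add_vecMul (derivAt_mul hU u (Pi.single j 1))
  rw [hA.holoShear_map_evalAt, hA.holoShear_map_derivAt hU] at hvar
  have htrace := trace_dressed_mul_variation hdet hlu.eigen hvar K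
  rw [atInfinity_add, atInfinity_sub, atInfinity_mul, atInfinity_mul, mul_add, Matrix.trace_add,
    mul_sub, Matrix.trace_sub, ← trace_mul_mul_comm_of_mul_comm (dressed_mul_comm hdet hlu.eigen K),
    sub_self, add_zero, hlu.derivative_deform hr (hA.gaugeFixed u u.2) (hA.hasTimes u u.2)
      (Nat.succ_le_of_lt j.2), mul_laurent_smul, Matrix.trace_smul, smul_eq_mul] at htrace
  have hcoeff := trace_mulMat_qPow_mul_coeff_one (n := n) (y.map (derivAt hU u (Pi.single j 1))) K
  rw [← htrace, HahnSeries.C_apply, HahnSeries.coeff_single_mul, sub_zero] at hcoeff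
  exact hcoeff.symm

theorem eqOn_hamiltonian (hr : 2 ≤ r) (hl : IsEigenrow hA.holoShear l y) (K : ℕ) :
    Set.EqOn (fun t => hamiltonian (A t) t K)
      (fun t => 1 / (K : ℂ) * (n * extendZero (y.coeff (n + K)) t)) U := by
  intro t ht
  beta_reduce
  rw [hamiltonian, (isEigenrow_evalAt hl ⟨t, ht⟩).spectralBranch_eq hr (hA.gaugeFixed t ht)
    (hA.hasTimes t ht), residue_qPow_mul, extendZero_apply _ ⟨t, ht⟩]
  rfl

theorem differentiableOn_hamiltonian (hr : 2 ≤ r) (hA : IsDeformation n r U A) (K : ℕ) :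
    DifferentiableOn ℂ (fun t => hamiltonian (A t) t K) U := by
  obtain ⟨l, y, hl⟩ := hA.exists_isEigenrow_holoShear hr
  exact (((differentiableOn_extendZero _).const_mul _).const_mul _).congr
    (eqOn_hamiltonian hr hl K)

theorem fderiv_hamiltonian (hr : 2 ≤ r) (hU : IsOpen U) (hl : IsEigenrow hA.holoShear l y) (u : U)
    (j : Fin (r * n)) (K : ℕ) :
    fderiv ℂ (fun t => hamiltonian (A t) t K) u (Pi.single j 1) =
      1 / (K : ℂ) * (1 / ((j + 1 : ℕ) : ℂ) * (dressed (fun i => (l i).map (evalAt u)) K *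
        ((dressed (fun i => (l i).map (evalAt u)) (j + 1)).map nonnegPart).map
          ddx).trace.coeff 1) := by
  have hdiff := differentiableAt_extendZero hU (y.coeff (n + K)) u
  rw [((eqOn_hamiltonian hr hl K).eventuallyEq_of_mem (hU.mem_nhds u.2)).fderiv_eq,
    fderiv_const_mul (hdiff.const_mul _), fderiv_const_mul hdiff,
    ← natCast_mul_derivAt_coeff hr hU hl]
  rfl

theorem fderiv_hamiltonian_comm (hr : 2 ≤ r) (hU : IsOpen U) (hA : IsDeformation n r U A)
    {t : Fin (r * n) → ℂ} (ht : t ∈ U) (j k : Fin (r * n)) :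
    fderiv ℂ (fun t => hamiltonian (A t) t (k + 1)) t (Pi.single j 1) =
      fderiv ℂ (fun t => hamiltonian (A t) t (j + 1)) t (Pi.single k 1) := by
  obtain ⟨l, y, hl⟩ := hA.exists_isEigenrow_holoShear hr
  have hlt := isEigenrow_evalAt hl ⟨t, ht⟩
  rw [fderiv_hamiltonian hr hU hl ⟨t, ht⟩, fderiv_hamiltonian hr hU hl ⟨t, ht⟩,
    residue_trace_dressed_symm (IsUnipotent.unshear hlt.integral hlt.coeff_zero).isUnit_det
      j.1.succ_pos k.1.succ_pos, mul_left_comm]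

end IsDeformation

theorem isClosedOn_sum_smul_proj {N : ℕ} {U : Set (Fin N → ℂ)} (hU : IsOpen U)
    {f : Fin N → (Fin N → ℂ) → ℂ} (hf : ∀ k, DifferentiableOn ℂ (f k) U)
    (hsymm : ∀ t ∈ U, ∀ j k,
      fderiv ℂ (f k) t (Pi.single j 1) = fderiv ℂ (f j) t (Pi.single k 1)) :
    IsClosedOn (fun t => ∑ k, f k t • ContinuousLinearMap.proj (R := ℂ) (φ := fun _ => ℂ) k) U := by
  let π (k : Fin N) : (Fin N → ℂ) →L[ℂ] ℂ := ContinuousLinearMap.proj k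
  have hder : ∀ t ∈ U, HasFDerivAt (fun t => ∑ k, f k t • π k)
      (∑ k, (fderiv ℂ (f k) t).smulRight (π k)) t := fun t ht =>
    HasFDerivAt.fun_sum fun k _ =>
      ((hf k).differentiableAt (hU.mem_nhds ht)).hasFDerivAt.smul_const (π k)
  refine ⟨fun t ht => (hder t ht).differentiableAt.differentiableWithinAt, fun t ht u v => ?_⟩
  have hexpand : ∀ (k : Fin N) (u : Fin N → ℂ),
      fderiv ℂ (f k) t u = ∑ j, u j * fderiv ℂ (f k) t (Pi.single j 1) := fun k u => by
    conv_lhs => rw [pi_eq_sum_univ' u, map_sum]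
    simp only [map_smul, smul_eq_mul]
  simp only [(hder t ht).fderiv, sum_apply, ContinuousLinearMap.smulRight_apply,
    smul_apply, π, ContinuousLinearMap.proj_apply, smul_eq_mul, hexpand _ u, hexpand _ v,
    Finset.sum_mul]
  rw [Finset.sum_comm, sub_eq_zero]
  refine Finset.sum_congr rfl fun j _ => Finset.sum_congr rfl fun k _ => ?_
  rw [hsymm t ht]
  ring

end PolyConn

end

theorem mainTheorem9 (n r : ℕ) (hn : 1 ≤ n) (hr : 2 ≤ r) (U : Set (Fin (r * n) → ℂ)) (hU : IsOpen U)
    (A : (Fin (r * n) → ℂ) → Matrix (Fin n) (Fin n) (Polynomial ℂ))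
    (hA : PolyConn.IsDeformation n r U A) :
    PolyConn.IsClosedOn (PolyConn.tauForm A) U := by
  have : NeZero n := ⟨by omega⟩
  exact PolyConn.isClosedOn_sum_smul_proj hU (fun k => hA.differentiableOn_hamiltonian hr (k + 1))
    fun t ht => hA.fderiv_hamiltonian_comm hr hU ht
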